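/- **Setting.** Points $x_1,x_2,x_3,\dots$ of a metric space $(X,d)$ arrive online, in pairs; the sequence is fixed in advance by an oblivious adversary and unknown to the algorithm (repeated points are allowed). For $n\ge 0$ put $S_n=\{x_1,\dots,x_{2n}\}$. A *randomized online algorithm* draws a random seed once and, after the $n$-th pair has arrived, outputs a perfect matching $M_n$ of the $2n$ points seen so far; $M_n$ depends only on the seed and on the distances $d(x_i,x_j)$, $i,j\le 2n$. The weight $\mathrm{Cost}(M)$ of a matching is the sum of the distances of its matched pairs, and $\mathrm{OPT}_n$ is the minimum weight of a perfect matching of $x_1,\dots,x_{2n}$. The recourse in the step from $n$ to $n+1$ pairs is the number $|M_n\setminus M_{n+1}|$ of deleted edges. $\Phi_n$ denotes the aspect ratio of $S_n$ (largest distance divided by smallest nonzero distance; $\log\Phi_n$ is read as $0$ if $S_n$ has fewer than two distinct points). $\mathrm{ddim}_n$ denotes the doubling dimension of the metric space $S_n$, that is, $\log_2\lambda$ for the least $\lambda$ such that every ball of radius $2r$ in $S_n$ is covered by $\lambda$ balls of radius $r$ (for every $r>0$). **Theorem.** There is an absolute constant $C>0$ such that the following two statements hold. 1. There is a randomized online algorithm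 such that for every metric space, every sequence of points in it, and every $n\ge 0$, $$\mathbb E[\mathrm{Cost}(M_n)]\le C\cdot \mathrm{ddim}_n\cdot(1+\log\Phi_n)\cdot\mathrm{OPT}_n ,$$ and, for every outcome of the seed, $|M_n\setminus M_{n+1}|\le C\,(1+\log \Phi_{n+1})$. 2. There is a randomized online algorithm such that for every metric space, every sequence of points in it, and every $n\ge 0$, $$\mathbb E[\mathrm{Cost}(M_n)]\le C\cdot \mathrm{ddim}_n\cdot(1+\log\Phi_n)\cdot\mathrm{OPT}_n ,$$ and, for every outcome of the seed, $|M_n\setminus M_{n+1}|\le C\,\log^3 (n+1)$. In particular, neither algorithm knows the number of points, the aspect ratio or the doubling dimension in advance. -/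

import Mathlib

universe u

namespace OnlineMatching

/-- `M` is a perfect matching of the complete graph on the index set `{0, …, m - 1}`, given as a
set of edges: every edge joins two different indices below `m`, and every index below `m` lies on
exactly one edge. Points are referred to by their arrival index, so equal points may recur. -/
def IsPerfectMatching (m : ℕ) (M : Finset (Sym2 ℕ)) : Prop :=
  (∀ e ∈ M, ¬ e.IsDiag ∧ ∀ v ∈ e, v < m) ∧ ∀ v < m, ∃! e, e ∈ M ∧ v ∈ e

section Metric

variable {X : Type u} [MetricSpace X]

/-- The weight of a set of edges: the sum of the distances between matched points. -/
noncomputable def cost (x : ℕ → X) (M : Finset (Sym2 ℕ)) : ℝ :=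
  ∑ e ∈ M, Sym2.lift ⟨fun i j => dist (x i) (x j), fun _ _ => dist_comm _ _⟩ e

/-- The minimum weight of a perfect matching on the first `m` points (`m` even). -/
noncomputable def optCost (x : ℕ → X) (m : ℕ) : ℝ :=
  sInf {c : ℝ | ∃ M, IsPerfectMatching m M ∧ c = cost x M}

/-- The set of the first `m` points of the sequence. -/
def firstPoints (x : ℕ → X) (m : ℕ) : Set X := x '' Set.Iio m

/-- In the metric space induced on `S`, every ball of radius `2 * r` is covered by at most `k`
balls of radius `r` (with centers in `S`). -/
def IsDoublingConstant (S : Set X) (k : ℕ) : Prop :=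
  ∀ p ∈ S, ∀ r : ℝ, 0 < r → ∃ t : Finset X, (t : Set X) ⊆ S ∧ t.card ≤ k ∧
    S ∩ Metric.closedBall p (2 * r) ⊆ ⋃ y ∈ t, Metric.closedBall y r

/-- The doubling dimension of the metric space induced on the (finite) set `S`:
the base-2 logarithm of the least doubling constant. -/
noncomputable def ddim (S : Set X) : ℝ :=
  Real.logb 2 (sInf {k : ℕ | IsDoublingConstant S k} : ℕ)

/-- The aspect ratio of a finite set `S` with at least two elements: its largest distance over
the smallest distance between two distinct elements. -/
noncomputable def aspectRatio (S : Set X) : ℝ := Metric.diam S / S.infsep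

/-- The distances between the first `m` points: all that an algorithm has seen when `m` points
have arrived. -/
def revealed (x : ℕ → X) (m : ℕ) : Fin m → Fin m → ℝ := fun i j => dist (x i) (x j)

end Metric

/-- A randomized online algorithm that maintains a perfect matching. A random seed `ω` is drawn
once, independently of the input. After `n` pairs of points have arrived, the algorithm outputs a
perfect matching of the `2 * n` points seen so far, as a function of the seed and of the distances
between these points alone. Neither the future points nor their number is known to it. -/
structure RandomizedAlgorithm where
  /-- the space of random seeds -/
  Ω : Type
  [mΩ : MeasurableSpace Ω]
  /-- the distribution of the random seed -/
  μ : MeasureTheory.Measure Ω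
  [prob : MeasureTheory.IsProbabilityMeasure μ]
  /-- the matching that is output after `n` pairs -/
  output : (n : ℕ) → (Fin (2 * n) → Fin (2 * n) → ℝ) → Ω → Finset (Sym2 ℕ)
  perfect : ∀ n D ω, IsPerfectMatching (2 * n) (output n D ω)
  measurable : ∀ n D M, MeasurableSet {ω | output n D ω = M}

attribute [instance] RandomizedAlgorithm.mΩ RandomizedAlgorithm.prob

namespace RandomizedAlgorithm

variable {X : Type u} [MetricSpace X] (A : RandomizedAlgorithm)

/-- The matching that `A` holds on the first `2 * n` points of the sequence `x`, for seed `ω`. -/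
def matching (x : ℕ → X) (n : ℕ) (ω : A.Ω) : Finset (Sym2 ℕ) :=
  A.output n (revealed x (2 * n)) ω

/-- The expected weight of the matching on the first `2 * n` points. -/
noncomputable def expectedCost (x : ℕ → X) (n : ℕ) : ℝ :=
  ∫ ω, cost x (A.matching x n ω) ∂A.μ

/-- The number of edges that `A` deletes when the matching on `2 * n` points is replaced by the one
on `2 * (n + 1)` points. -/
def recourse (x : ℕ → X) (n : ℕ) (ω : A.Ω) : ℕ :=
  (A.matching x n ω \ A.matching x (n + 1) ω).card

end RandomizedAlgorithm

end OnlineMatching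

namespace OnlineMatching

open scoped Classical

/-! ### Pairings and swaps -/

/-! A single algorithm serves both statements. The seed determines a random hierarchy of clusters in
which level `i` has diameter at most `2 ^ i`. The algorithm maintains a pairing that is near-optimal
for this hierarchy and changes little per arrival.

Random hierarchy. At scale `2 ^ k`, each point of a greedy net gets a ball of random radius between
`2 ^ k / 4` and `2 ^ k / 2`, and every point joins the earliest net point whose ball contains it.
The radii are truncated exponentials. A net point with `κ` earlier net points nearby uses rate `log
(1 + (κ + 1) * (κ + 2))`, so the truncation errors `1 / ((κ + 1) * (κ + 2))` sum to at most `1`, and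
no doubling constant `c` need be known in advance. Since `κ ≤ c ^ 4`, points at distance `δ` are
separated with probability `O(ddim * δ / 2 ^ k)` (`measureReal_center_ne_le`,
`measureReal_center_ne_le_ddim`). Level `i` is the common refinement of all scales `k ≥ i`. Centers
depend only on the point and earlier ones, so clusters are never revised.

Cost. Let a cluster `H` have parent `A`. If `|H| ≤ 3/4 |A|`, at most one point of `H` may be matched
outside `H`; otherwise at most one point of `A \ H` may be matched outside `A \ H`. By parity, the
number of points separated at a level exceeds that of the parent level by at most the number of odd
clusters on the two levels, and every pairing separates a point of each odd cluster
(`sepCount_le_succ`). With the geometric weights `2 ^ i` the recursion sums up, and the cost is at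
most a constant times the hierarchical cost of any competitor (`Balanced.sum_dist_le`). The
expectation of the latter is `O(ddim)` times its true cost for each of the `O(1 + log Φ)` levels.

Recourse. The caps `capIn` and `capOut` interpolate between the two regimes, so that one arrival
changes them by at most `3`. They can fail only at levels where the cluster of the new point is
light, and there only around two clusters (`Balanced.insert_cases`). Each failure is repaired by
swaps that harm no other member of a laminar family (`exists_swap`). Light levels number at most
`O(1 + log Φ)`, because all other levels are trivial, and at most `O(1 + log n)`, because the
cluster size grows by a factor `4/3` at each of them. -/

/-- A fixed-point-free involution of `ℕ` that preserves `U`. -/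
structure IsPairing (U : Finset ℕ) (σ : ℕ → ℕ) : Prop where
  invol : ∀ v, σ (σ v) = v
  ne_self : ∀ v, σ v ≠ v
  maps : ∀ v ∈ U, σ v ∈ U

/-- The number of points of `S` whose partner lies outside `S`. -/
noncomputable def free (σ : ℕ → ℕ) (S : Finset ℕ) : ℕ := (S.filter fun v => σ v ∉ S).card

lemma free_le_card (σ : ℕ → ℕ) (S : Finset ℕ) : free σ S ≤ S.card := Finset.card_filter_le _ _

/-- The points matched within `S` come in pairs. This turns a bound "at most one free point" into
the exact value `S.card % 2`. -/
lemma IsPairing.free_mod_two {U : Finset ℕ} {σ : ℕ → ℕ} (h : IsPairing U σ) (S : Finset ℕ) :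
    free σ S % 2 = S.card % 2 := by
  have key : ((S.filter fun v => σ v ∈ S).card : ZMod 2) = 0 := by
    rw [Finset.card_eq_sum_ones, Nat.cast_sum]
    refine Finset.sum_involution (fun v _ => σ v) ?_ ?_ ?_ ?_
    · intro v _; decide
    · intro v _ _; exact h.ne_self v
    · intro v hv
      simp only [Finset.mem_filter] at hv ⊢
      exact ⟨hv.2, by rw [h.invol]; exact hv.1⟩
    · intro v _; exact h.invol v
  have h2 : 2 ∣ (S.filter fun v => σ v ∈ S).card := (ZMod.natCast_eq_zero_iff _ 2).1 key
  have h3 := Finset.card_filter_add_card_filter_not (s := S) (fun v => σ v ∈ S)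
  unfold free
  omega

/-- Any two of the sets are nested or disjoint. -/
def IsLaminar (F : Set (Finset ℕ)) : Prop :=
  ∀ S ∈ F, ∀ T ∈ F, S ⊆ T ∨ T ⊆ S ∨ Disjoint S T

/-- `τ` is a pairing that arises from `σ` by at most `k` local changes inside `U`, none of which
increases the number of free points in a member of the family `F`. -/
structure Improves (F : Set (Finset ℕ)) (U : Finset ℕ) (k : ℕ) (σ τ : ℕ → ℕ) : Prop where
  pairing : IsPairing U τ
  eq_off : ∀ v, v ∉ U → τ v = σ v
  card_le : (U.filter fun v => τ v ≠ σ v).card ≤ 4 * k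
  free_le : ∀ T ∈ F, free τ T ≤ free σ T

lemma Improves.refl {F : Set (Finset ℕ)} {U : Finset ℕ} {σ : ℕ → ℕ} (h : IsPairing U σ) :
    Improves F U 0 σ σ :=
  ⟨h, fun _ _ => rfl, by simp, fun _ _ => le_rfl⟩

lemma Improves.mono {F : Set (Finset ℕ)} {U : Finset ℕ} {k l : ℕ} {σ τ : ℕ → ℕ}
    (h : Improves F U k σ τ) (hkl : k ≤ l) : Improves F U l σ τ :=
  ⟨h.pairing, h.eq_off, h.card_le.trans (by omega), h.free_le⟩

lemma card_filter_ne_trans (U : Finset ℕ) (ρ σ τ : ℕ → ℕ) :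
    (U.filter fun v => τ v ≠ ρ v).card ≤
      (U.filter fun v => σ v ≠ ρ v).card + (U.filter fun v => τ v ≠ σ v).card := by
  refine (Finset.card_le_card ?_).trans (Finset.card_union_le _ _)
  intro v hv
  simp only [Finset.mem_filter, Finset.mem_union] at hv ⊢
  by_cases hc : σ v = ρ v
  · exact Or.inr ⟨hv.1, fun h => hv.2 (h.trans hc)⟩
  · exact Or.inl ⟨hv.1, hc⟩

lemma Improves.trans {F : Set (Finset ℕ)} {U : Finset ℕ} {k l : ℕ} {ρ σ τ : ℕ → ℕ}
    (h : Improves F U k ρ σ) (h' : Improves F U l σ τ) : Improves F U (k + l) ρ τ := by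
  refine ⟨h'.pairing, fun v hv => (h'.eq_off v hv).trans (h.eq_off v hv), ?_,
    fun T hT => (h'.free_le T hT).trans (h.free_le T hT)⟩
  have := card_filter_ne_trans U ρ σ τ
  have := h.card_le
  have := h'.card_le
  omega

/-- Two free points of a member of a laminar family can be matched to each other, and their
partners as well, without increasing the number of free points of any member. -/
lemma exists_swap {F : Set (Finset ℕ)} (hF : IsLaminar F) {U : Finset ℕ} {σ : ℕ → ℕ}
    (hσ : IsPairing U σ) {S : Finset ℕ} (hS : S ∈ F) (hSU : S ⊆ U) (h2 : 2 ≤ free σ S) :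
    ∃ τ, Improves F U 1 σ τ ∧ free τ S + 2 ≤ free σ S := by
  obtain ⟨q, hq, s, hs, hqs⟩ := Finset.one_lt_card.1 (show 1 < (S.filter fun v => σ v ∉ S).card
    from h2)
  rw [Finset.mem_filter] at hq hs
  obtain ⟨hqS, hwS⟩ := hq
  obtain ⟨hsS, hwS'⟩ := hs
  obtain ⟨w, hw⟩ : ∃ w, w = σ q := ⟨_, rfl⟩
  obtain ⟨w', hw'⟩ : ∃ w', w' = σ s := ⟨_, rfl⟩
  rw [← hw] at hwS
  rw [← hw'] at hwS'
  have hσw : σ w = q := by rw [hw, hσ.invol]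
  have hσw' : σ w' = s := by rw [hw', hσ.invol]
  have hww' : w ≠ w' := fun h => hqs (by rw [← hσw, ← hσw', h])
  have hqw : q ≠ w := fun h => hwS (h ▸ hqS)
  have hqw' : q ≠ w' := fun h => hwS' (h ▸ hqS)
  have hsw : s ≠ w := fun h => hwS (h ▸ hsS)
  have hsw' : s ≠ w' := fun h => hwS' (h ▸ hsS)
  -- Conjugation by the transposition of `q` and `w'` turns the edges `qw`, `sw'` into `qs`, `ww'`,
  -- and it preserves fixed-point-free involutions.
  set τ : ℕ → ℕ := fun v => Equiv.swap q w' (σ (Equiv.swap q w' v)) with hτ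
  have τq : τ q = s := by
    simp only [hτ, Equiv.swap_apply_left, hσw']
    exact Equiv.swap_apply_of_ne_of_ne hqs.symm hsw'
  have τs : τ s = q := by
    simp only [hτ, Equiv.swap_apply_of_ne_of_ne hqs.symm hsw', ← hw', Equiv.swap_apply_right]
  have τw : τ w = w' := by
    simp only [hτ, Equiv.swap_apply_of_ne_of_ne hqw.symm hww', hσw, Equiv.swap_apply_left]
  have τw' : τ w' = w := by
    simp only [hτ, Equiv.swap_apply_right, ← hw]
    exact Equiv.swap_apply_of_ne_of_ne hqw.symm hww'
  have τo : ∀ v, v ≠ q → v ≠ s → v ≠ w → v ≠ w' → τ v = σ v := by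
    intro v h1 h2 h3 h4
    simp only [hτ, Equiv.swap_apply_of_ne_of_ne h1 h4]
    refine Equiv.swap_apply_of_ne_of_ne (fun h => h3 ?_) (fun h => h2 ?_)
    · rw [hw, ← h, hσ.invol]
    · rw [← hσw', ← h, hσ.invol]
  have hqU := hSU hqS
  have hsU := hSU hsS
  have hwU : w ∈ U := hw ▸ hσ.maps q hqU
  have hwU' : w' ∈ U := hw' ▸ hσ.maps s hsU
  have hpair : IsPairing U τ := by
    refine ⟨fun v => by simp [hτ, hσ.invol], fun v h => ?_, fun v hv => ?_⟩
    · have := congrArg (Equiv.swap q w') h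
      simp only [hτ, Equiv.swap_apply_self] at this
      exact hσ.ne_self _ this
    · by_cases h1 : v = q
      · rw [h1, τq]; exact hsU
      by_cases h2 : v = s
      · rw [h2, τs]; exact hqU
      by_cases h3 : v = w
      · rw [h3, τw]; exact hwU'
      by_cases h4 : v = w'
      · rw [h4, τw']; exact hwU
      rw [τo v h1 h2 h3 h4]; exact hσ.maps v hv
  have hmono : ∀ T ∈ F, free τ T ≤ free σ T := by
    intro T hT
    unfold free
    -- A superset of `S` contains `q` and `s`, and `ww'` crosses its boundary only if exactly one
    -- old edge did. A subset of `S` misses `w` and `w'`, so `q` and `s` were already free in it if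
    -- present. A set disjoint from `S` misses `q` and `s`, so the same holds for `w` and `w'`.
    rcases hF S hS T hT with hST | hTS | hd
    · have hqT := hST hqS
      have hsT := hST hsS
      by_cases hwT : w ∈ T
      · by_cases hwT' : w' ∈ T
        · refine Finset.card_le_card fun v hv => ?_
          rw [Finset.mem_filter] at hv ⊢
          refine ⟨hv.1, ?_⟩
          rw [← τo v]
          · exact hv.2
          all_goals rintro rfl
          · rw [τq] at hv; exact hv.2 hsT
          · rw [τs] at hv; exact hv.2 hqT
          · rw [τw] at hv; exact hv.2 hwT'
          · rw [τw'] at hv; exact hv.2 hwT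
        · have hs1 : s ∈ T.filter fun v => σ v ∉ T := by
            rw [Finset.mem_filter, ← hw']; exact ⟨hsT, hwT'⟩
          have : (T.filter fun v => τ v ∉ T) ⊆ insert w ((T.filter fun v => σ v ∉ T).erase s) := by
            intro v hv
            rw [Finset.mem_filter] at hv
            rw [Finset.mem_insert, Finset.mem_erase, Finset.mem_filter]
            by_cases hvw : v = w
            · exact Or.inl hvw
            have hvs : v ≠ s := by rintro rfl; rw [τs] at hv; exact hv.2 hqT
            refine Or.inr ⟨hvs, hv.1, ?_⟩
            rw [← τo v ?_ hvs hvw ?_]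
            · exact hv.2
            · rintro rfl; rw [τq] at hv; exact hv.2 hsT
            · rintro rfl; exact hwT' hv.1
          have h5 := Finset.card_le_card this
          have h6 := Finset.card_insert_le w ((T.filter fun v => σ v ∉ T).erase s)
          have h7 := Finset.card_erase_add_one hs1
          omega
      · by_cases hwT' : w' ∈ T
        · have hq1 : q ∈ T.filter fun v => σ v ∉ T := by
            rw [Finset.mem_filter, ← hw]; exact ⟨hqT, hwT⟩
          have : (T.filter fun v => τ v ∉ T) ⊆ insert w' ((T.filter fun v => σ v ∉ T).erase q) := by
            intro v hv
            rw [Finset.mem_filter] at hv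
            rw [Finset.mem_insert, Finset.mem_erase, Finset.mem_filter]
            by_cases hvw : v = w'
            · exact Or.inl hvw
            have hvq : v ≠ q := by rintro rfl; rw [τq] at hv; exact hv.2 hsT
            refine Or.inr ⟨hvq, hv.1, ?_⟩
            rw [← τo v hvq ?_ ?_ hvw]
            · exact hv.2
            · rintro rfl; rw [τs] at hv; exact hv.2 hqT
            · rintro rfl; exact hwT hv.1
          have h5 := Finset.card_le_card this
          have h6 := Finset.card_insert_le w' ((T.filter fun v => σ v ∉ T).erase q)
          have h7 := Finset.card_erase_add_one hq1
          omega
        · refine Finset.card_le_card fun v hv => ?_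
          rw [Finset.mem_filter] at hv ⊢
          refine ⟨hv.1, ?_⟩
          rw [← τo v]
          · exact hv.2
          all_goals rintro rfl
          · rw [τq] at hv; exact hv.2 hsT
          · rw [τs] at hv; exact hv.2 hqT
          · exact hwT hv.1
          · exact hwT' hv.1
    · refine Finset.card_le_card fun v hv => ?_
      rw [Finset.mem_filter] at hv ⊢
      refine ⟨hv.1, ?_⟩
      by_cases h1 : v = q
      · rw [h1, ← hw]; exact fun h => hwS (hTS h)
      by_cases h2 : v = s
      · rw [h2, ← hw']; exact fun h => hwS' (hTS h)
      rw [← τo v h1 h2]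
      · exact hv.2
      · rintro rfl; exact hwS (hTS hv.1)
      · rintro rfl; exact hwS' (hTS hv.1)
    · rw [Finset.disjoint_left] at hd
      refine Finset.card_le_card fun v hv => ?_
      rw [Finset.mem_filter] at hv ⊢
      refine ⟨hv.1, ?_⟩
      by_cases h3 : v = w
      · rw [h3, hσw]; exact hd hqS
      by_cases h4 : v = w'
      · rw [h4, hσw']; exact hd hsS
      rw [← τo v ?_ ?_ h3 h4]
      · exact hv.2
      · rintro rfl; exact hd hqS hv.1
      · rintro rfl; exact hd hsS hv.1
  refine ⟨τ, ⟨hpair, fun v hv => ?_, ?_, hmono⟩, ?_⟩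
  · refine τo v ?_ ?_ ?_ ?_ <;> rintro rfl <;> exact hv ‹_›
  · refine (Finset.card_le_card (t := {q, s, w, w'}) fun v hv => ?_).trans
      (Finset.card_le_four.trans (by norm_num))
    rw [Finset.mem_filter] at hv
    simp only [Finset.mem_insert, Finset.mem_singleton]
    by_contra hcon
    push Not at hcon
    exact hv.2 (τo v hcon.1 hcon.2.1 hcon.2.2.1 hcon.2.2.2)
  · have hq1 : q ∈ S.filter fun v => σ v ∉ S := by
      rw [Finset.mem_filter, ← hw]; exact ⟨hqS, hwS⟩
    have hs1 : s ∈ (S.filter fun v => σ v ∉ S).erase q := by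
      rw [Finset.mem_erase, Finset.mem_filter, ← hw']; exact ⟨hqs.symm, hsS, hwS'⟩
    have hsub : (S.filter fun v => τ v ∉ S) ⊆ ((S.filter fun v => σ v ∉ S).erase q).erase s := by
      intro v hv
      rw [Finset.mem_filter] at hv
      rw [Finset.mem_erase, Finset.mem_erase, Finset.mem_filter]
      have hvq : v ≠ q := by rintro rfl; rw [τq] at hv; exact hv.2 hsS
      have hvs : v ≠ s := by rintro rfl; rw [τs] at hv; exact hv.2 hqS
      refine ⟨hvs, hvq, hv.1, ?_⟩
      rw [← τo v hvq hvs]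
      · exact hv.2
      · rintro rfl; exact hwS hv.1
      · rintro rfl; exact hwS' hv.1
    have h5 := Finset.card_le_card hsub
    have h6 := Finset.card_erase_add_one hq1
    have h7 := Finset.card_erase_add_one hs1
    unfold free
    omega

/-- As `b ≥ 1`, a violated bound leaves two free points to swap. Each swap removes two of them, so
`e` swaps are more than enough. -/
lemma exists_reduce {F : Set (Finset ℕ)} (hF : IsLaminar F) {U S : Finset ℕ} (hS : S ∈ F)
    (hSU : S ⊆ U) {b : ℕ} (hb : 1 ≤ b) (e : ℕ) :
    ∀ σ : ℕ → ℕ, IsPairing U σ → free σ S ≤ b + e → ∃ τ, Improves F U e σ τ ∧ free τ S ≤ b := by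
  induction e with
  | zero => exact fun σ hσ h => ⟨σ, Improves.refl hσ, h⟩
  | succ e ih =>
    intro σ hσ h
    by_cases hle : free σ S ≤ b
    · exact ⟨σ, (Improves.refl hσ).mono (Nat.zero_le _), hle⟩
    obtain ⟨τ, hτ, hτS⟩ := exists_swap hF hσ hS hSU (by omega)
    obtain ⟨ρ, hρ, hρS⟩ := ih τ hτ.pairing (by omega)
    exact ⟨ρ, (hτ.trans hρ).mono (by omega), hρS⟩

/-- Finitely many members of a laminar family, each with at most `e` free points too many, can be
repaired by `e` swaps for each of them. Sets outside the family are allowed if their bound is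
trivial. -/
lemma exists_reduce_all {F : Set (Finset ℕ)} (hF : IsLaminar F) {U : Finset ℕ} {ι : Type*}
    (S : ι → Finset ℕ) (b : ι → ℕ) (e : ℕ) (I : Finset ι)
    (hI : ∀ i ∈ I, (S i ∈ F ∨ (S i).card ≤ b i) ∧ S i ⊆ U ∧ 1 ≤ b i) (σ : ℕ → ℕ)
    (hσ : IsPairing U σ) (hfree : ∀ i ∈ I, free σ (S i) ≤ b i + e) :
    ∃ τ, Improves F U (e * I.card) σ τ ∧ ∀ i ∈ I, free τ (S i) ≤ b i := by
  induction I using Finset.induction_on with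
  | empty => exact ⟨σ, Improves.refl hσ, by simp⟩
  | insert j I hj ih =>
    obtain ⟨τ, hτ, hτI⟩ := ih (fun i hi => hI i (Finset.mem_insert_of_mem hi))
      (fun i hi => hfree i (Finset.mem_insert_of_mem hi))
    obtain ⟨hSj, hSU, hbj⟩ := hI j (Finset.mem_insert_self _ _)
    have hfj := hfree j (Finset.mem_insert_self _ _)
    rw [Finset.card_insert_of_notMem hj, Nat.mul_succ]
    rcases hSj with hSj | hSj
    · obtain ⟨ρ, hρ, hρj⟩ := exists_reduce hF hSj hSU hbj e τ hτ.pairing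
        ((hτ.free_le _ hSj).trans hfj)
      refine ⟨ρ, hτ.trans hρ, fun i hi => ?_⟩
      rcases Finset.mem_insert.1 hi with rfl | hi
      · exact hρj
      · rcases (hI i (Finset.mem_insert_of_mem hi)).1 with h | h
        · exact (hρ.free_le _ h).trans (hτI i hi)
        · exact (free_le_card _ _).trans h
    · refine ⟨τ, hτ.mono (by omega), fun i hi => ?_⟩
      rcases Finset.mem_insert.1 hi with rfl | hi
      · exact (free_le_card _ _).trans hSj
      · exact hτI i hi

end OnlineMatching

namespace OnlineMatching

open scoped Classical

/-! ### Hierarchies and balanced pairings -/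

/-- An increasing family of equivalence relations on the indices. -/
structure IsHierarchy (R : ℤ → ℕ → ℕ → Prop) : Prop where
  equiv : ∀ i, Equivalence (R i)
  mono : ∀ i j, i ≤ j → ∀ a b, R i a b → R j a b

/-- The level-`i` cluster of `a` in `V`. -/
noncomputable def cls (R : ℤ → ℕ → ℕ → Prop) (V : Finset ℕ) (i : ℤ) (a : ℕ) : Finset ℕ :=
  V.filter fun v => R i a v

/-- The part of the parent cluster of `cls R V i a` that lies outside `cls R V i a`. -/
noncomputable def rest (R : ℤ → ℕ → ℕ → Prop) (V : Finset ℕ) (i : ℤ) (a : ℕ) : Finset ℕ :=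
  cls R V (i + 1) a \ cls R V i a

/-- How many free points are allowed in a cluster. -/
noncomputable def capIn (R : ℤ → ℕ → ℕ → Prop) (V : Finset ℕ) (i : ℤ) (a : ℕ) : ℕ :=
  1 + (4 * (cls R V i a).card - 3 * (cls R V (i + 1) a).card)

/-- How many free points are allowed in the complement of a cluster within its parent. -/
noncomputable def capOut (R : ℤ → ℕ → ℕ → Prop) (V : Finset ℕ) (i : ℤ) (a : ℕ) : ℕ :=
  1 + (3 * (cls R V (i + 1) a).card - 4 * (cls R V i a).card)

/-- A pairing that has few free points in light clusters, and few free points in the rest of the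
parent of a heavy cluster. -/
def Balanced (R : ℤ → ℕ → ℕ → Prop) (V : Finset ℕ) (σ : ℕ → ℕ) : Prop :=
  ∀ i : ℤ, ∀ a ∈ V, free σ (cls R V i a) ≤ capIn R V i a ∧ free σ (rest R V i a) ≤ capOut R V i a

/-- The levels at which the cluster of `x` is light in its parent. -/
def lightLevels (R : ℤ → ℕ → ℕ → Prop) (V : Finset ℕ) (x : ℕ) : Set ℤ :=
  {i | 4 * (cls R V i x).card < 3 * (cls R V (i + 1) x).card}

variable {R : ℤ → ℕ → ℕ → Prop} {V : Finset ℕ}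

/-! ### Elementary relations between clusters -/

lemma cls_subset (i : ℤ) (a : ℕ) : cls R V i a ⊆ V := Finset.filter_subset _ _

lemma mem_cls {i : ℤ} {a v : ℕ} : v ∈ cls R V i a ↔ v ∈ V ∧ R i a v := Finset.mem_filter

lemma mem_rest {i : ℤ} {a v : ℕ} : v ∈ rest R V i a ↔ v ∈ V ∧ R (i + 1) a v ∧ ¬ R i a v := by
  simp only [rest, Finset.mem_sdiff, mem_cls]
  tauto

lemma IsHierarchy.refl (hR : IsHierarchy R) (i : ℤ) (a : ℕ) : R i a a := (hR.equiv i).refl a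

lemma IsHierarchy.symm (hR : IsHierarchy R) {i : ℤ} {a b : ℕ} (h : R i a b) : R i b a :=
  (hR.equiv i).symm h

lemma IsHierarchy.trans (hR : IsHierarchy R) {i : ℤ} {a b c : ℕ} (h : R i a b) (h' : R i b c) :
    R i a c := (hR.equiv i).trans h h'

lemma IsHierarchy.succ (hR : IsHierarchy R) {i : ℤ} {a b : ℕ} (h : R i a b) : R (i + 1) a b :=
  hR.mono i (i + 1) (by omega) a b h

lemma IsHierarchy.iff_left (hR : IsHierarchy R) {i : ℤ} {a b : ℕ} (h : R i a b) (v : ℕ) :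
    R i a v ↔ R i b v :=
  ⟨fun h' => hR.trans (hR.symm h) h', fun h' => hR.trans h h'⟩

lemma cls_congr (hR : IsHierarchy R) {i : ℤ} {a b : ℕ} (h : R i a b) :
    cls R V i a = cls R V i b := by
  ext v; simp only [mem_cls, hR.iff_left h v]

lemma rest_congr (hR : IsHierarchy R) {i : ℤ} {a b : ℕ} (h : R i a b) :
    rest R V i a = rest R V i b := by
  rw [rest, rest, cls_congr hR h, cls_congr hR (hR.succ h)]

lemma capIn_congr (hR : IsHierarchy R) {i : ℤ} {a b : ℕ} (h : R i a b) :
    capIn R V i a = capIn R V i b := by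
  rw [capIn, capIn, cls_congr hR h, cls_congr hR (hR.succ h)]

lemma capOut_congr (hR : IsHierarchy R) {i : ℤ} {a b : ℕ} (h : R i a b) :
    capOut R V i a = capOut R V i b := by
  rw [capOut, capOut, cls_congr hR h, cls_congr hR (hR.succ h)]

lemma cls_subset_succ (hR : IsHierarchy R) (i : ℤ) (a : ℕ) :
    cls R V i a ⊆ cls R V (i + 1) a := by
  intro v hv
  rw [mem_cls] at hv ⊢
  exact ⟨hv.1, hR.succ hv.2⟩

lemma card_rest (hR : IsHierarchy R) (i : ℤ) (a : ℕ) :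
    (rest R V i a).card + (cls R V i a).card = (cls R V (i + 1) a).card :=
  Finset.card_sdiff_add_card_eq_card (cls_subset_succ hR i a)

/-- Two clusters with the same parent, which together are larger than it, coincide. -/
lemma rel_of_card_lt (hR : IsHierarchy R) {i : ℤ} {a b : ℕ} (hab : R (i + 1) a b)
    (h : (cls R V (i + 1) a).card < (cls R V i a).card + (cls R V i b).card) : R i a b := by
  by_contra hn
  have hd : Disjoint (cls R V i a) (cls R V i b) := by
    rw [Finset.disjoint_left]
    intro v hv hv'
    rw [mem_cls] at hv hv'
    exact hn (hR.trans hv.2 (hR.symm hv'.2))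
  have hsub : cls R V i a ∪ cls R V i b ⊆ cls R V (i + 1) a := by
    refine Finset.union_subset (cls_subset_succ hR i a) ?_
    rw [cls_congr hR hab]
    exact cls_subset_succ hR i b
  have := Finset.card_le_card hsub
  rw [Finset.card_union_of_disjoint hd] at this
  omega

/-- All clusters, and the complements of majority clusters within their parents. -/
def clusterFamily (R : ℤ → ℕ → ℕ → Prop) (V : Finset ℕ) : Set (Finset ℕ) :=
  {T | (∃ i a, T = cls R V i a) ∨
    ∃ i a, (cls R V (i + 1) a).card < 2 * (cls R V i a).card ∧ T = rest R V i a}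

/-! ### Laminarity of clusters and of complements of majority clusters -/

lemma cls_laminar_cls (hR : IsHierarchy R) {i j : ℤ} (hij : i ≤ j) (a b : ℕ) :
    cls R V i a ⊆ cls R V j b ∨ Disjoint (cls R V i a) (cls R V j b) := by
  by_cases h : R j a b
  · left
    rw [← cls_congr hR h]
    intro v hv
    rw [mem_cls] at hv ⊢
    exact ⟨hv.1, hR.mono i j hij _ _ hv.2⟩
  · right
    rw [Finset.disjoint_left]
    intro v hv hv'
    rw [mem_cls] at hv hv'
    exact h (hR.trans (hR.mono i j hij _ _ hv.2) (hR.symm hv'.2))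

lemma cls_laminar_rest (hR : IsHierarchy R) {i j : ℤ} (hij : i ≤ j) (a b : ℕ) :
    cls R V i a ⊆ rest R V j b ∨ Disjoint (cls R V i a) (rest R V j b) := by
  rcases cls_laminar_cls (V := V) hR hij a b with h | h
  · right
    exact Disjoint.mono_left h Finset.disjoint_sdiff
  · rcases cls_laminar_cls (V := V) hR (show i ≤ j + 1 by omega) a b with h' | h'
    · left
      intro v hv
      exact Finset.mem_sdiff.2 ⟨h' hv, Finset.disjoint_left.1 h hv⟩
    · right
      exact Disjoint.mono_right Finset.sdiff_subset h'

lemma cls_laminar_rest' (hR : IsHierarchy R) (i j : ℤ) (a b : ℕ) :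
    cls R V i a ⊆ rest R V j b ∨ rest R V j b ⊆ cls R V i a ∨
      Disjoint (cls R V i a) (rest R V j b) := by
  rcases le_or_gt i j with hij | hij
  · rcases cls_laminar_rest (V := V) hR hij a b with h | h <;> tauto
  · rcases cls_laminar_cls (V := V) hR (show j + 1 ≤ i by omega) b a with h | h
    · exact Or.inr (Or.inl (Finset.sdiff_subset.trans h))
    · exact Or.inr (Or.inr (Disjoint.mono_right Finset.sdiff_subset h.symm))

lemma rest_laminar_rest (hR : IsHierarchy R) {i j : ℤ} (hij : i < j) (a b : ℕ) :
    rest R V i a ⊆ rest R V j b ∨ Disjoint (rest R V i a) (rest R V j b) := by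
  rcases cls_laminar_rest (V := V) hR (show i + 1 ≤ j by omega) a b with h | h
  · exact Or.inl (Finset.sdiff_subset.trans h)
  · exact Or.inr (Disjoint.mono_left Finset.sdiff_subset h)

/-- The majority condition is needed only for two complements inside the same parent: a parent has
at most one majority child, so they coincide. Complements of two distinct children could cross. -/
lemma isLaminar_clusterFamily (hR : IsHierarchy R) (V : Finset ℕ) :
    IsLaminar (clusterFamily R V) := by
  rintro S (⟨i, a, rfl⟩ | ⟨i, a, ha, rfl⟩) T (⟨j, b, rfl⟩ | ⟨j, b, hb, rfl⟩)
  · rcases le_total i j with hij | hij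
    · rcases cls_laminar_cls (V := V) hR hij a b with h | h <;> tauto
    · rcases cls_laminar_cls (V := V) hR hij b a with h | h
      · tauto
      · exact Or.inr (Or.inr h.symm)
  · exact cls_laminar_rest' hR i j a b
  · rcases cls_laminar_rest' (V := V) hR j i b a with h | h | h
    · tauto
    · tauto
    · exact Or.inr (Or.inr h.symm)
  · rcases lt_trichotomy i j with hij | hij | hij
    · rcases rest_laminar_rest (V := V) hR hij a b with h | h <;> tauto
    · subst hij
      by_cases h : R (i + 1) a b
      · left
        have hab : R i a b := by
          refine rel_of_card_lt (V := V) hR h ?_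
          rw [← cls_congr hR h] at hb
          omega
        rw [rest_congr hR hab]
      · right; right
        rw [Finset.disjoint_left]
        intro v hv hv'
        rw [mem_rest] at hv hv'
        exact (h (hR.trans hv.2.1 (hR.symm hv'.2.1))).elim
    · rcases rest_laminar_rest (V := V) hR hij b a with h | h
      · tauto
      · exact Or.inr (Or.inr h.symm)

/-! ### The effect of one new point, and rebalancing -/

lemma free_insert_le (σ : ℕ → ℕ) (x : ℕ) (S : Finset ℕ) :
    free σ (insert x S) ≤ free σ S + 1 := by
  refine (Finset.card_le_card (t := insert x (S.filter fun v => σ v ∉ S)) fun v hv => ?_).trans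
    (Finset.card_insert_le _ _)
  rw [Finset.mem_filter, Finset.mem_insert, Finset.mem_insert] at hv
  rw [Finset.mem_insert, Finset.mem_filter]
  tauto

/-- Needed for the new point itself, which is not in `V` and whose cluster in `V` may be empty; the
caps of an empty cluster are trivially large. -/
lemma Balanced.all (hR : IsHierarchy R) {σ : ℕ → ℕ} (h : Balanced R V σ) (i : ℤ) (a : ℕ) :
    free σ (cls R V i a) ≤ capIn R V i a ∧ free σ (rest R V i a) ≤ capOut R V i a := by
  rcases (cls R V i a).eq_empty_or_nonempty with he | ⟨b, hb⟩
  · have h1 := card_rest (V := V) hR i a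
    have h2 := free_le_card σ (cls R V i a)
    have h3 := free_le_card σ (rest R V i a)
    rw [he, Finset.card_empty] at h1 h2
    simp only [capIn, capOut, he, Finset.card_empty] at h2 ⊢
    omega
  · rw [mem_cls] at hb
    rw [cls_congr hR hb.2, rest_congr hR hb.2, capIn_congr hR hb.2, capOut_congr hR hb.2]
    exact h i b hb.1

lemma cls_insert_of_rel {x : ℕ} {i : ℤ} {a : ℕ} (h : R i a x) :
    cls R (insert x V) i a = insert x (cls R V i a) := by
  rw [cls, Finset.filter_insert, if_pos h, cls]

lemma cls_insert_of_not_rel {x : ℕ} {i : ℤ} {a : ℕ} (h : ¬ R i a x) :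
    cls R (insert x V) i a = cls R V i a := by
  rw [cls, Finset.filter_insert, if_neg h, cls]

/-- The effect of a new point on the bounds: they can only fail, and then by at most `3`, at levels
where the cluster of the new point is light, and there only for that cluster and for its unique
heavy sibling. -/
lemma Balanced.insert_cases (hR : IsHierarchy R) {σ : ℕ → ℕ} (h : Balanced R V σ) {x : ℕ}
    (hx : x ∉ V) (i : ℤ) (a : ℕ) :
    (free σ (cls R (insert x V) i a) ≤ capIn R (insert x V) i a ∧
      free σ (rest R (insert x V) i a) ≤ capOut R (insert x V) i a) ∨
    (i ∈ lightLevels R V x ∧ free σ (cls R (insert x V) i a) ≤ capIn R (insert x V) i a + 3 ∧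
      free σ (rest R (insert x V) i a) ≤ capOut R (insert x V) i a + 3 ∧
      (R i x a ∨ (R (i + 1) x a ∧
        3 * (cls R V (i + 1) a).card < 4 * (cls R V i a).card))) := by
  obtain ⟨h1, h2⟩ := h.all hR i a
  have hc := card_rest (V := V) hR i a
  -- With `H` the cluster and `A` its parent, `4|H| - 3|A|` rises by 1 if `x` joins both and falls
  -- by 3 if `x` joins only `A`. In the first case the caps absorb the change when `H` is not light,
  -- in the second when `4|H| ≤ 3|A|`. If they do not in the second case, `H` takes more than 3/4 of
  -- `A`, so the cluster of `x` is a light sibling.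
  by_cases hA : R (i + 1) a x
  · have hxA : x ∉ cls R V (i + 1) a := fun hh => hx (cls_subset _ _ hh)
    have eA := cls_insert_of_rel (V := V) hA
    have cA : (cls R (insert x V) (i + 1) a).card = (cls R V (i + 1) a).card + 1 := by
      rw [eA, Finset.card_insert_of_notMem hxA]
    by_cases hH : R i a x
    · have hxH : x ∉ cls R V i a := fun hh => hx (cls_subset _ _ hh)
      have eH := cls_insert_of_rel (V := V) hH
      have cH : (cls R (insert x V) i a).card = (cls R V i a).card + 1 := by
        rw [eH, Finset.card_insert_of_notMem hxH]
      have eU : rest R (insert x V) i a = rest R V i a := by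
        rw [rest, eA, eH, rest]
        ext v
        simp only [Finset.mem_sdiff, Finset.mem_insert]
        constructor
        · tauto
        · rintro ⟨hv, hv'⟩
          refine ⟨Or.inr hv, ?_⟩
          rintro (rfl | hh)
          · exact hxA hv
          · exact hv' hh
      have f1 := free_insert_le σ x (cls R V i a)
      rw [← eH] at f1
      rw [eU]
      simp only [capIn, capOut, cA, cH] at *
      by_cases hl : 4 * (cls R V i a).card < 3 * (cls R V (i + 1) a).card
      · right
        refine ⟨?_, by omega, by omega, Or.inl (hR.symm hH)⟩
        rw [lightLevels, Set.mem_ofPred_eq, ← cls_congr hR hH, ← cls_congr hR hA]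
        exact hl
      · left; omega
    · have eH := cls_insert_of_not_rel (V := V) hH
      have eU : rest R (insert x V) i a = insert x (rest R V i a) := by
        rw [rest, eA, eH, rest, Finset.insert_sdiff_of_notMem]
        exact fun hh => hx (cls_subset _ _ hh)
      have f2 := free_insert_le σ x (rest R V i a)
      rw [← eU] at f2
      simp only [capIn, capOut, cA, eH] at *
      by_cases hl : 3 * (cls R V (i + 1) a).card < 4 * (cls R V i a).card
      · right
        refine ⟨?_, by omega, by omega, Or.inr ⟨hR.symm hA, hl⟩⟩
        have := mt (rel_of_card_lt (V := V) hR hA) hH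
        rw [lightLevels, Set.mem_ofPred_eq, ← cls_congr hR hA]
        omega
      · left; omega
  · have hH : ¬ R i a x := fun hh => hA (hR.succ hh)
    left
    have eA := cls_insert_of_not_rel (V := V) hA
    have eH := cls_insert_of_not_rel (V := V) hH
    simp only [capIn, capOut, rest, eA, eH] at *
    exact ⟨h1, h2⟩

/-- The complement of a cluster with at most half of its parent may violate laminarity, but its cap
then exceeds its size, so it needs no care. -/
lemma rest_mem_clusterFamily (hR : IsHierarchy R) (V : Finset ℕ) (i : ℤ) (a : ℕ) :
    rest R V i a ∈ clusterFamily R V ∨ (rest R V i a).card ≤ capOut R V i a := by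
  by_cases h : (cls R V (i + 1) a).card < 2 * (cls R V i a).card
  · exact Or.inl (Or.inr ⟨i, a, h, rfl⟩)
  · right
    have := card_rest (V := V) hR i a
    rw [capOut]
    omega

/-- A balanced pairing can be rebalanced after the arrival of a new point by a number of changes
that is proportional to the number of levels at which the new point lies in a light cluster. -/
lemma Balanced.exists_insert (hR : IsHierarchy R) {U : Finset ℕ} {σ : ℕ → ℕ}
    (hσ : IsPairing U σ) (h : Balanced R V σ) {x : ℕ} (hx : x ∉ V) (hU : insert x V ⊆ U)
    (hfin : (lightLevels R V x).Finite) :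
    ∃ τ, IsPairing U τ ∧ (∀ v, v ∉ U → τ v = σ v) ∧
      (U.filter fun v => τ v ≠ σ v).card ≤ 48 * (lightLevels R V x).ncard ∧
      Balanced R (insert x V) τ := by
  -- Two disjoint children cannot both exceed 3/4 of the parent, so one representative per level
  -- accounts for every heavy sibling; if there is none, any value will do.
  have hheavy : ∀ i : ℤ, ∃ y : ℕ, ∀ a, R (i + 1) x a →
      3 * (cls R V (i + 1) a).card < 4 * (cls R V i a).card → R i y a := by
    intro i
    by_cases hex : ∃ y, R (i + 1) x y ∧ 3 * (cls R V (i + 1) y).card < 4 * (cls R V i y).card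
    · obtain ⟨y, hy, hy'⟩ := hex
      refine ⟨y, fun a ha ha' => rel_of_card_lt (V := V) hR (hR.trans (hR.symm hy) ha) ?_⟩
      rw [← cls_congr hR ha] at ha'
      rw [← cls_congr hR hy] at hy' ⊢
      omega
    · exact ⟨x, fun a ha ha' => (hex ⟨a, ha, ha'⟩).elim⟩
  choose y hy using hheavy
  have hcases := fun i a => h.insert_cases hR hx i a
  set V' := insert x V with hV'
  -- The first flag chooses between the cluster of `x` and its heavy sibling, the second between a
  -- cluster and its complement. Four sets per light level, excess 3 for each and 4 changed points
  -- per swap give the factor 48.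
  let I : Finset (ℤ × Bool × Bool) := hfin.toFinset ×ˢ (Finset.univ ×ˢ Finset.univ)
  let pt : ℤ × Bool × Bool → ℕ := fun t => if t.2.1 then x else y t.1
  let S : ℤ × Bool × Bool → Finset ℕ := fun t =>
    if t.2.2 then cls R V' t.1 (pt t) else rest R V' t.1 (pt t)
  let b : ℤ × Bool × Bool → ℕ := fun t =>
    if t.2.2 then capIn R V' t.1 (pt t) else capOut R V' t.1 (pt t)
  have hbound : ∀ i a, free σ (cls R V' i a) ≤ capIn R V' i a + 3 ∧
      free σ (rest R V' i a) ≤ capOut R V' i a + 3 := by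
    intro i a
    rcases hcases i a with ⟨h1, h2⟩ | ⟨_, h1, h2, _⟩
    · exact ⟨by omega, by omega⟩
    · exact ⟨h1, h2⟩
  obtain ⟨τ, hτ, hτI⟩ := exists_reduce_all (isLaminar_clusterFamily hR V') (U := U) S b 3 I
    (by
      rintro ⟨i, c, d⟩ _
      cases d
      · exact ⟨rest_mem_clusterFamily hR V' _ _, (Finset.sdiff_subset.trans
          (cls_subset _ _)).trans hU, Nat.le_add_right _ _⟩
      · exact ⟨Or.inl (Or.inl ⟨_, _, rfl⟩), (cls_subset _ _).trans hU, Nat.le_add_right _ _⟩)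
    σ hσ
    (by
      rintro ⟨i, c, d⟩ _
      cases d
      · exact (hbound _ _).2
      · exact (hbound _ _).1)
  refine ⟨τ, hτ.pairing, hτ.eq_off, ?_, fun i a _ => ?_⟩
  · refine hτ.card_le.trans ?_
    simp only [I, Finset.card_product, Finset.card_univ, Fintype.card_bool]
    rw [Set.ncard_eq_toFinset_card _ hfin]
    omega
  · rcases hcases i a with ⟨h1, h2⟩ | ⟨hi, -, -, hor⟩
    · refine ⟨(hτ.free_le _ (Or.inl ⟨i, a, rfl⟩)).trans h1, ?_⟩
      rcases rest_mem_clusterFamily hR V' i a with hm | hm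
      · exact (hτ.free_le _ hm).trans h2
      · exact (free_le_card _ _).trans hm
    · have key : ∃ c : Bool, R i (pt (i, c, true)) a := by
        rcases hor with hh | ⟨hh, hh'⟩
        · exact ⟨true, hh⟩
        · exact ⟨false, hy i a hh hh'⟩
      obtain ⟨c, hc⟩ := key
      have m : ∀ d, ((i, c, d) : ℤ × Bool × Bool) ∈ I := by
        intro d
        simp only [I, Finset.mem_product, Set.Finite.mem_toFinset, Finset.mem_univ, and_true]
        exact hi
      have i1 := hτI _ (m true)
      have i2 := hτI _ (m false)
      have hc' : R i (pt (i, c, false)) a := hc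
      simp only [S, b, if_true, Bool.false_eq_true, if_false] at i1 i2
      rw [cls_congr hR hc, capIn_congr hR hc] at i1
      rw [rest_congr hR hc', capOut_congr hR hc'] at i2
      exact ⟨i1, i2⟩

end OnlineMatching

namespace OnlineMatching

open scoped Classical

variable {R : ℤ → ℕ → ℕ → Prop} {V : Finset ℕ}

/-! ### The number of light levels -/

/-- Being light forces the parent to be strictly larger than the cluster, which fails wherever the
hierarchy has stabilized. -/
lemma lightLevels_subset_Ico {x : ℕ} {lo hi : ℤ}
    (hlo : ∀ i < lo, ∀ v ∈ V, R (i + 1) x v → R i x v)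
    (hhi : ∀ i, hi ≤ i → ∀ v ∈ V, R i x v) :
    lightLevels R V x ⊆ Set.Ico lo hi := by
  intro i hi'
  rw [lightLevels, Set.mem_ofPred_eq] at hi'
  have key : ¬ cls R V (i + 1) x ⊆ cls R V i x := fun h => by
    have := Finset.card_le_card h
    omega
  refine ⟨?_, ?_⟩
  · by_contra hlt
    refine key fun v hv => ?_
    rw [mem_cls] at hv ⊢
    exact ⟨hv.1, hlo i (by omega) v hv.1 hv.2⟩
  · by_contra hlt
    refine key fun v hv => ?_
    rw [mem_cls] at hv ⊢
    exact ⟨hv.1, hhi i (by omega) v hv.1⟩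

lemma card_cls_mono (hR : IsHierarchy R) {i j : ℤ} (hij : i ≤ j) (x : ℕ) :
    (cls R V i x).card ≤ (cls R V j x).card := by
  refine Finset.card_le_card fun v hv => ?_
  rw [mem_cls] at hv ⊢
  exact ⟨hv.1, hR.mono i j hij _ _ hv.2⟩

/-- Each light level multiplies the cluster size by more than `4/3`. The lowest one is not counted
in the exponent: `x` need not lie in `V`, so the cluster there may be empty, and only its parent is
known to have a point. -/
lemma pow_card_lightLevels_le (hR : IsHierarchy R) {x : ℕ} (I : Finset ℤ) :
    (I : Set ℤ) ⊆ lightLevels R V x → I.Nonempty → ∀ j : ℤ, (∀ i ∈ I, i < j) →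
      4 ^ (I.card - 1) ≤ 3 ^ (I.card - 1) * (cls R V j x).card := by
  induction I using Finset.induction_on_max with
  | empty => intro _ h; simp at h
  | insert a I hmax ih =>
    intro hI _ j hj
    have ha : a ∉ I := fun h => lt_irrefl _ (hmax a h)
    have haL : a ∈ lightLevels R V x := hI (by simp)
    rw [lightLevels, Set.mem_ofPred_eq] at haL
    have haj : a + 1 ≤ j := hj a (Finset.mem_insert_self _ _)
    have hle := card_cls_mono (V := V) hR haj x
    rw [Finset.card_insert_of_notMem ha, Nat.add_sub_cancel]
    rcases I.eq_empty_or_nonempty with rfl | hne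
    · simp only [Finset.card_empty, pow_zero, one_mul]
      omega
    · have h1 := ih (fun i hi => hI (Finset.mem_coe.2 (Finset.mem_insert_of_mem hi))) hne a hmax
      obtain ⟨k, hk⟩ : ∃ k, I.card = k + 1 := ⟨I.card - 1, by
        have := hne.card_pos
        omega⟩
      rw [hk, Nat.add_sub_cancel] at h1
      rw [hk, pow_succ, pow_succ]
      calc 4 ^ k * 4 ≤ 3 ^ k * (cls R V a x).card * 4 := Nat.mul_le_mul_right _ h1
        _ = 3 ^ k * (4 * (cls R V a x).card) := by ring
        _ ≤ 3 ^ k * (3 * (cls R V j x).card) := Nat.mul_le_mul_left _ (by omega)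
        _ = 3 ^ k * 3 * (cls R V j x).card := by ring

lemma ncard_lightLevels_le_log (hR : IsHierarchy R) {x : ℕ}
    (hfin : (lightLevels R V x).Finite) {m : ℕ} (hm : 1 ≤ m) (hV : V.card ≤ m) :
    ((lightLevels R V x).ncard : ℝ) ≤ 1 + 4 * Real.log m := by
  have hlog : 0 ≤ Real.log m := Real.log_nonneg (by exact_mod_cast hm)
  rw [Set.ncard_eq_toFinset_card _ hfin]
  set I := hfin.toFinset with hI
  rcases I.eq_empty_or_nonempty with he | hne
  · rw [he]; simp; linarith
  obtain ⟨k, hk⟩ : ∃ k, I.card = k + 1 := ⟨I.card - 1, by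
    have := hne.card_pos
    omega⟩
  have h1 := pow_card_lightLevels_le hR I (by rw [hI, hfin.coe_toFinset]) hne (I.max' hne + 1)
    (fun i hi => Int.lt_add_one_of_le (I.le_max' i hi))
  rw [hk, Nat.add_sub_cancel] at h1
  have h2 : 4 ^ k ≤ 3 ^ k * m :=
    h1.trans (Nat.mul_le_mul_left _ ((Finset.card_le_card (cls_subset _ _)).trans hV))
  have h3 : ((4 : ℝ) / 3) ^ k ≤ m := by
    rw [div_pow, div_le_iff₀ (by positivity), mul_comm]
    exact_mod_cast h2
  have h4 := Real.log_le_log (by positivity) h3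
  rw [Real.log_pow] at h4
  have h5 : (1 : ℝ) / 4 ≤ Real.log (4 / 3) := by
    have := Real.one_sub_inv_le_log_of_pos (show (0 : ℝ) < 4 / 3 by norm_num)
    norm_num at this ⊢
    linarith
  rw [hk]
  push_cast
  nlinarith [(Nat.cast_nonneg k : (0 : ℝ) ≤ k)]

/-! ### Separated pairs at the levels of a hierarchy -/

/-- The number of points of `V` that `R i` separates from their partner. -/
noncomputable def sepCount (R : ℤ → ℕ → ℕ → Prop) (V : Finset ℕ) (σ : ℕ → ℕ) (i : ℤ) : ℕ :=
  (V.filter fun v => ¬ R i v (σ v)).card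

/-- The clusters of level `i`. -/
noncomputable def clusters (R : ℤ → ℕ → ℕ → Prop) (V : Finset ℕ) (i : ℤ) : Finset (Finset ℕ) :=
  V.image (cls R V i)

lemma cls_eq_cls_iff (hR : IsHierarchy R) {i : ℤ} {a b : ℕ} (hb : b ∈ V) :
    cls R V i a = cls R V i b ↔ R i a b := by
  refine ⟨fun h => ?_, cls_congr hR⟩
  have : b ∈ cls R V i a := by
    rw [h, mem_cls]
    exact ⟨hb, hR.refl i b⟩
  exact (mem_cls.1 this).2

lemma sepCount_eq_sum (hR : IsHierarchy R) {σ : ℕ → ℕ} (hσ : IsPairing V σ) (i : ℤ) :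
    sepCount R V σ i = ∑ C ∈ clusters R V i, free σ C := by
  rw [sepCount, Finset.card_eq_sum_card_fiberwise (f := cls R V i) (t := clusters R V i)]
  · refine Finset.sum_congr rfl fun C hC => ?_
    obtain ⟨a, ha, rfl⟩ := Finset.mem_image.1 hC
    unfold free
    congr 1
    ext v
    simp only [Finset.mem_filter, mem_cls, not_and]
    constructor
    · rintro ⟨⟨hv, hn⟩, he⟩
      rw [cls_eq_cls_iff hR ha] at he
      exact ⟨⟨hv, hR.symm he⟩, fun _ h => hn (hR.trans he h)⟩
    · rintro ⟨⟨hv, hav⟩, hn⟩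
      exact ⟨⟨hv, fun h => hn (hσ.maps v hv) (hR.trans hav h)⟩,
        (cls_eq_cls_iff hR ha).2 (hR.symm hav)⟩
  · intro v hv
    exact Finset.mem_coe.2 (Finset.mem_image_of_mem _ (Finset.mem_filter.1 hv).1)

/-- The lower bound for any competitor: an odd cluster cannot be matched within itself. -/
lemma sum_card_mod_two_le (hR : IsHierarchy R) {τ : ℕ → ℕ} (hτ : IsPairing V τ) (i : ℤ) :
    ∑ C ∈ clusters R V i, C.card % 2 ≤ sepCount R V τ i := by
  rw [sepCount_eq_sum hR hτ]
  refine Finset.sum_le_sum fun C _ => ?_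
  rw [← hτ.free_mod_two]
  exact Nat.mod_le _ _

/-- In the non-heavy case the cap is 1 and parity decides. In the heavy case the partner of a free
point lies outside the parent or in the complement; the complement has at most one free point, and
its parity is that of the two cluster sizes together. -/
lemma free_cls_le (hR : IsHierarchy R) {U : Finset ℕ} {σ : ℕ → ℕ} (hσ : IsPairing U σ)
    (h : Balanced R V σ) (i : ℤ) {a : ℕ} (ha : a ∈ V) :
    free σ (cls R V i a) ≤ (cls R V i a).card % 2 +
      if 3 * (cls R V (i + 1) a).card < 4 * (cls R V i a).card then
        free σ (cls R V (i + 1) a) + (cls R V (i + 1) a).card % 2 else 0 := by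
  obtain ⟨h1, h2⟩ := h i a ha
  have p1 := hσ.free_mod_two (cls R V i a)
  split_ifs with hh
  · have p2 := hσ.free_mod_two (rest R V i a)
    have hc := card_rest (V := V) hR i a
    have hsub : free σ (cls R V i a) ≤ free σ (cls R V (i + 1) a) + free σ (rest R V i a) := by
      -- The free points of the complement are counted through their partners, which are then
      -- compared with the free points of the cluster.
      have hb : free σ (rest R V i a) =
          ((rest R V i a).image σ |>.filter fun v => σ v ∈ rest R V i a ∧
            v ∉ rest R V i a).card := by
        unfold free
        rw [← Finset.card_image_of_injective _ (Function.Involutive.injective hσ.invol)]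
        congr 1
        ext v
        simp only [Finset.mem_image, Finset.mem_filter]
        constructor
        · rintro ⟨u, ⟨hu, hu'⟩, rfl⟩
          exact ⟨⟨u, hu, rfl⟩, by rwa [hσ.invol], hu'⟩
        · rintro ⟨⟨u, hu, rfl⟩, h3, h4⟩
          exact ⟨u, ⟨hu, h4⟩, rfl⟩
      rw [hb]
      unfold free
      refine (Finset.card_le_card fun v hv => ?_).trans (Finset.card_union_le _ _)
      rw [Finset.mem_filter] at hv
      rw [Finset.mem_union, Finset.mem_filter, Finset.mem_filter, Finset.mem_image]
      by_cases hσv : σ v ∈ cls R V (i + 1) a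
      · have hr : σ v ∈ rest R V i a := Finset.mem_sdiff.2 ⟨hσv, hv.2⟩
        exact Or.inr ⟨⟨σ v, hr, hσ.invol v⟩, hr, fun hn => (Finset.mem_sdiff.1 hn).2 hv.1⟩
      · exact Or.inl ⟨cls_subset_succ hR i a hv.1, hσv⟩
    rw [capOut] at h2
    omega
  · rw [capIn] at h1
    omega

/-- For a balanced pairing, passing from the parents to the children increases the number of
separated points by no more than the number of odd clusters on the two levels. -/
lemma sepCount_le_succ (hR : IsHierarchy R) {σ τ : ℕ → ℕ} (hσ : IsPairing V σ)
    (hτ : IsPairing V τ) (h : Balanced R V σ) (i : ℤ) :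
    sepCount R V σ i ≤ sepCount R V σ (i + 1) + sepCount R V τ i + sepCount R V τ (i + 1) := by
  set par : Finset ℕ → Finset ℕ := fun C => V.filter fun v => ∃ c ∈ C, R (i + 1) c v with hpar
  have par_cls : ∀ a ∈ V, par (cls R V i a) = cls R V (i + 1) a := by
    intro a ha
    ext v
    simp only [hpar, Finset.mem_filter, mem_cls]
    constructor
    · rintro ⟨hv, c, ⟨_, hc⟩, hcv⟩
      exact ⟨hv, hR.trans (hR.succ hc) hcv⟩
    · rintro ⟨hv, hav⟩
      exact ⟨hv, a, ⟨ha, hR.refl i a⟩, hav⟩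
  have step : ∀ C ∈ clusters R V i, free σ C ≤ C.card % 2 +
      if 3 * (par C).card < 4 * C.card then free σ (par C) + (par C).card % 2 else 0 := by
    intro C hC
    obtain ⟨a, ha, rfl⟩ := Finset.mem_image.1 hC
    rw [par_cls a ha]
    exact free_cls_le hR hσ h i ha
  have heavy : (∑ C ∈ clusters R V i,
      if 3 * (par C).card < 4 * C.card then free σ (par C) + (par C).card % 2 else 0) ≤
      ∑ A ∈ clusters R V (i + 1), (free σ A + A.card % 2) := by
    -- Distinct heavy clusters have distinct parents, so each parent is charged at most once.
    rw [← Finset.sum_filter]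
    have hinj : Set.InjOn par
        ((clusters R V i).filter fun C => 3 * (par C).card < 4 * C.card : Finset (Finset ℕ)) := by
      intro C hC D hD hCD
      rw [Finset.mem_coe, Finset.mem_filter] at hC hD
      obtain ⟨hC, hC'⟩ := hC
      obtain ⟨hD, hD'⟩ := hD
      obtain ⟨a, ha, rfl⟩ := Finset.mem_image.1 hC
      obtain ⟨b, hb, rfl⟩ := Finset.mem_image.1 hD
      rw [par_cls a ha] at hC' hCD
      rw [par_cls b hb] at hD' hCD
      have hab := (cls_eq_cls_iff hR hb).1 hCD
      refine cls_congr hR (rel_of_card_lt (V := V) hR hab ?_)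
      rw [← hCD] at hD'
      omega
    rw [← Finset.sum_image (f := fun A => free σ A + A.card % 2) hinj]
    refine Finset.sum_le_sum_of_subset ?_
    intro A hA
    obtain ⟨C, hC, rfl⟩ := Finset.mem_image.1 hA
    obtain ⟨a, ha, rfl⟩ := Finset.mem_image.1 (Finset.mem_filter.1 hC).1
    rw [par_cls a ha]
    exact Finset.mem_image_of_mem _ ha
  have hsum := Finset.sum_le_sum step
  rw [Finset.sum_add_distrib, ← sepCount_eq_sum hR hσ] at hsum
  rw [Finset.sum_add_distrib, ← sepCount_eq_sum hR hσ] at heavy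
  have o1 := sum_card_mod_two_le hR hτ i
  have o2 := sum_card_mod_two_le hR hτ (i + 1)
  omega

/-- Shifting the index by one halves a weighted sum, so the hypothesis reads `ΣF ≤ ΣF / 2 + (3 / 2)
ΣG` after summation. -/
lemma sum_two_pow_mul_le (N : ℕ) (F G : ℕ → ℝ) (hF : 0 ≤ F 0) (hG : 0 ≤ G 0)
    (hFN : F N = 0) (hGN : G N = 0) (h : ∀ k, F k ≤ F (k + 1) + G k + G (k + 1)) :
    ∑ k ∈ Finset.range N, 2 ^ k * F k ≤ 3 * ∑ k ∈ Finset.range N, 2 ^ k * G k := by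
  have shift : ∀ H : ℕ → ℝ, 0 ≤ H 0 → H N = 0 →
      2 * ∑ k ∈ Finset.range N, 2 ^ k * H (k + 1) ≤ ∑ k ∈ Finset.range N, 2 ^ k * H k := by
    intro H h0 hN
    have h1 := Finset.sum_range_succ (fun k => (2 : ℝ) ^ k * H k) N
    rw [Finset.sum_range_succ'] at h1
    rw [Finset.mul_sum]
    have h2 : ∑ k ∈ Finset.range N, 2 * ((2 : ℝ) ^ k * H (k + 1)) =
        ∑ k ∈ Finset.range N, (2 : ℝ) ^ (k + 1) * H (k + 1) :=
      Finset.sum_congr rfl fun k _ => by ring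
    rw [h2]
    rw [hN] at h1
    linarith
  have hsum : ∑ k ∈ Finset.range N, 2 ^ k * F k ≤
      ∑ k ∈ Finset.range N, (2 ^ k * F (k + 1) + 2 ^ k * G k + 2 ^ k * G (k + 1)) :=
    Finset.sum_le_sum fun k _ => by
      have := mul_le_mul_of_nonneg_left (h k) (show (0 : ℝ) ≤ 2 ^ k by positivity)
      linarith
  rw [Finset.sum_add_distrib, Finset.sum_add_distrib] at hsum
  have := shift F hF hFN
  have := shift G hG hGN
  linarith

/-- The highest separated level alone pays for the distance: one level above it the points share a
cluster, whose diameter is twice its weight. -/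
lemma dist_le_sum_levels (d : ℕ → ℕ → ℝ) (lo : ℤ) (v w : ℕ) (hlo : R lo v w → d v w = 0)
    (hd : ∀ i, R i v w → d v w ≤ 2 ^ i) (N : ℕ) (hN : R (lo + N) v w) :
    d v w ≤ 2 * ∑ k ∈ Finset.range N, 2 ^ (lo + k) * (if R (lo + k) v w then (0 : ℝ) else 1) := by
  induction N with
  | zero =>
    rw [hlo (by simpa using hN)]
    simp
  | succ N ih =>
    have hnn : 0 ≤ ∑ k ∈ Finset.range N,
        (2 : ℝ) ^ (lo + k) * (if R (lo + k) v w then (0 : ℝ) else 1) :=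
      Finset.sum_nonneg fun k _ => mul_nonneg (by positivity) (by split_ifs <;> norm_num)
    rw [Finset.sum_range_succ]
    by_cases h : R (lo + N) v w
    · rw [if_pos h, mul_zero, add_zero]
      exact ih h
    · rw [if_neg h, mul_one]
      have h1 := hd _ hN
      have h2 : (2 : ℝ) ^ (lo + ((N + 1 : ℕ) : ℤ)) = 2 * 2 ^ (lo + (N : ℤ)) := by
        rw [Nat.cast_succ, ← add_assoc, zpow_add_one₀ two_ne_zero, mul_comm]
      rw [h2] at h1
      linarith

lemma sum_ite_rel (V : Finset ℕ) (σ : ℕ → ℕ) (i : ℤ) :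
    ∑ v ∈ V, (if R i v (σ v) then (0 : ℝ) else 1) = sepCount R V σ i := by
  rw [sepCount, Finset.card_filter]
  push_cast
  refine Finset.sum_congr rfl fun v _ => ?_
  split_ifs <;> simp

/-- The weight of a balanced pairing is controlled by the levels at which the hierarchy separates
the edges of any other pairing. -/
lemma Balanced.sum_dist_le (hR : IsHierarchy R) {σ τ : ℕ → ℕ} (hσ : IsPairing V σ)
    (hτ : IsPairing V τ) (h : Balanced R V σ) (d : ℕ → ℕ → ℝ) (lo : ℤ) (N : ℕ)
    (hlo : ∀ v ∈ V, ∀ w ∈ V, R lo v w → d v w = 0)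
    (hd : ∀ v ∈ V, ∀ w ∈ V, ∀ i, R i v w → d v w ≤ 2 ^ i)
    (hN : ∀ v ∈ V, ∀ w ∈ V, R (lo + N) v w) :
    ∑ v ∈ V, d v (σ v) ≤
      6 * ∑ k ∈ Finset.range N, (2 : ℝ) ^ (lo + k) * sepCount R V τ (lo + k) := by
  have h1 : ∑ v ∈ V, d v (σ v) ≤
      2 * ∑ k ∈ Finset.range N, (2 : ℝ) ^ (lo + k) * sepCount R V σ (lo + k) := by
    refine (Finset.sum_le_sum fun v hv => dist_le_sum_levels d lo v (σ v)
      (hlo v hv _ (hσ.maps v hv)) (hd v hv _ (hσ.maps v hv)) N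
      (hN v hv _ (hσ.maps v hv))).trans_eq ?_
    rw [← Finset.mul_sum, Finset.sum_comm]
    congr 1
    refine Finset.sum_congr rfl fun k _ => ?_
    rw [← Finset.mul_sum, sum_ite_rel]
  have zero_top : ∀ ρ : ℕ → ℕ, IsPairing V ρ → sepCount R V ρ (lo + N) = 0 := by
    intro ρ hρ
    rw [sepCount, Finset.card_eq_zero, Finset.filter_eq_empty_iff]
    exact fun v hv => not_not.2 (hN v hv _ (hρ.maps v hv))
  have h2 := sum_two_pow_mul_le N (fun k => (sepCount R V σ (lo + k) : ℝ))
    (fun k => (sepCount R V τ (lo + k) : ℝ)) (Nat.cast_nonneg _) (Nat.cast_nonneg _)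
    (by simp [zero_top σ hσ]) (by simp [zero_top τ hτ]) (fun k => by
      have := sepCount_le_succ hR hσ hτ h (lo + k)
      rw [add_assoc lo] at this
      exact_mod_cast this)
  have h3 : ∀ ρ : ℕ → ℕ, ∑ k ∈ Finset.range N, (2 : ℝ) ^ (lo + k) * sepCount R V ρ (lo + k) =
      2 ^ lo * ∑ k ∈ Finset.range N, (2 : ℝ) ^ k * sepCount R V ρ (lo + k) := by
    intro ρ
    rw [Finset.mul_sum]
    refine Finset.sum_congr rfl fun k _ => ?_
    rw [zpow_add₀ two_ne_zero, zpow_natCast, mul_assoc]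
  rw [h3] at h1 ⊢
  have h4 := mul_le_mul_of_nonneg_left h2 (show (0 : ℝ) ≤ 2 ^ lo by positivity)
  linarith

end OnlineMatching

namespace OnlineMatching

open scoped Classical

/-! ### Random partitions at all scales -/

/-- `d` is a pseudometric on the indices. -/
structure IsPseudo (d : ℕ → ℕ → ℝ) : Prop where
  self : ∀ a, d a a = 0
  symm : ∀ a b, d a b = d b a
  tri : ∀ a b c, d a c ≤ d a b + d b c

lemma IsPseudo.nonneg {d : ℕ → ℕ → ℝ} (hd : IsPseudo d) (a b : ℕ) : 0 ≤ d a b := by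
  have h1 := hd.tri a b a
  rw [hd.self, hd.symm b a] at h1
  linarith

lemma IsPseudo.eq_of_zero {d : ℕ → ℕ → ℝ} (hd : IsPseudo d) {a b : ℕ} (h : d a b = 0) (u : ℕ) :
    d u a = d u b := by
  have h1 := hd.tri u a b
  have h2 := hd.tri u b a
  rw [hd.symm b a] at h2
  linarith

/-- The greedy net of separation `2 ^ k / 4` of the first `j` points. -/
noncomputable def net (d : ℕ → ℕ → ℝ) (k : ℤ) : ℕ → Finset ℕ
  | 0 => ∅
  | j + 1 => if ∀ u ∈ net d k j, (2 : ℝ) ^ k / 4 < d u j then insert j (net d k j) else net d k j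

/-- The number of net points near `u` that arrived before `u`. -/
noncomputable def rank (d : ℕ → ℕ → ℝ) (k : ℤ) (u : ℕ) : ℕ :=
  ((net d k u).filter fun w => d w u ≤ 2 * 2 ^ k).card

/-- The rate of the truncated exponential distribution that a net point of rank `κ` uses. -/
noncomputable def rate (κ : ℕ) : ℝ := Real.log (1 + (κ + 1) * (κ + 2))

/-- The distribution function of a truncated exponential variable. -/
noncomputable def thr (κ : ℕ) (t : ℝ) : ℝ :=
  (1 - Real.exp (-(rate κ * t))) / (1 - Real.exp (-rate κ))

/-- The seeds: one number in the unit interval for each point. -/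
abbrev Seed : Type := ℕ → unitInterval

/-- `u` is a net point at scale `2 ^ k` whose random ball contains `j`. -/
def Captures (d : ℕ → ℕ → ℝ) (k : ℤ) (ω : Seed) (u j : ℕ) : Prop :=
  u ∈ net d k (u + 1) ∧ thr (rank d k u) (4 * d u j / 2 ^ k - 1) ≤ ω u

/-- The first net point whose random ball contains `j`. -/
noncomputable def center (d : ℕ → ℕ → ℝ) (k : ℤ) (ω : Seed) (j : ℕ) : ℕ :=
  sInf {u | Captures d k ω u j}

/-- The hierarchy of common refinements of the random partitions. -/
def levelRel (d : ℕ → ℕ → ℝ) (ω : Seed) (i : ℤ) (a b : ℕ) : Prop :=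
  ∀ k, i ≤ k → center d k ω a = center d k ω b

lemma isHierarchy_levelRel (d : ℕ → ℕ → ℝ) (ω : Seed) : IsHierarchy (levelRel d ω) :=
  ⟨fun _ => ⟨fun _ _ _ => rfl, fun h k hk => (h k hk).symm,
    fun h h' k hk => (h k hk).trans (h' k hk)⟩,
    fun _ _ hij _ _ h k hk => h k (hij.trans hk)⟩

/-! ### The truncated exponential distribution -/

lemma rate_pos (κ : ℕ) : 0 < rate κ := Real.log_pos (by
  have : (0 : ℝ) ≤ κ := Nat.cast_nonneg κ
  nlinarith)

lemma exp_neg_rate (κ : ℕ) : Real.exp (-rate κ) = (1 + ((κ : ℝ) + 1) * (κ + 2))⁻¹ := by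
  rw [Real.exp_neg, rate, Real.exp_log (by positivity)]

lemma one_sub_exp_pos (κ : ℕ) : 0 < 1 - Real.exp (-rate κ) := by
  have := Real.exp_lt_one_iff.2 (neg_lt_zero.2 (rate_pos κ))
  linarith

lemma thr_nonpos (κ : ℕ) {t : ℝ} (ht : t ≤ 0) : thr κ t ≤ 0 := by
  refine div_nonpos_of_nonpos_of_nonneg ?_ (one_sub_exp_pos κ).le
  have : 1 ≤ Real.exp (-(rate κ * t)) := Real.one_le_exp (by nlinarith [rate_pos κ])
  linarith

lemma one_lt_thr (κ : ℕ) {t : ℝ} (ht : 1 < t) : 1 < thr κ t := by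
  rw [thr, one_lt_div (one_sub_exp_pos κ)]
  have : Real.exp (-(rate κ * t)) < Real.exp (-rate κ) :=
    Real.exp_lt_exp.2 (by nlinarith [rate_pos κ])
  linarith

lemma thr_zero (κ : ℕ) : thr κ 0 = 0 := by simp [thr]

lemma thr_mono (κ : ℕ) {s t : ℝ} (h : s ≤ t) : thr κ s ≤ thr κ t := by
  refine div_le_div_of_nonneg_right ?_ (one_sub_exp_pos κ).le
  have : Real.exp (-(rate κ * t)) ≤ Real.exp (-(rate κ * s)) :=
    Real.exp_le_exp.2 (by nlinarith [rate_pos κ])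
  linarith

/-- The hazard rate of the truncated exponential distribution is almost constant. -/
lemma thr_sub_le (κ : ℕ) (s t : ℝ) :
    thr κ t - thr κ s ≤
      rate κ * (t - s) * (1 - thr κ s + 1 / (((κ : ℝ) + 1) * (κ + 2))) := by
  have hp := one_sub_exp_pos κ
  set q := Real.exp (-rate κ) with hq
  have hq' : q = (1 + ((κ : ℝ) + 1) * (κ + 2))⁻¹ := exp_neg_rate κ
  have hk : (0 : ℝ) < ((κ : ℝ) + 1) * (κ + 2) := by positivity
  -- This identity dictates the choice of `rate`: the truncation error `q / (1 - q)` becomes a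
  -- telescoping term.
  have he : 1 / (((κ : ℝ) + 1) * (κ + 2)) = q / (1 - q) := by
    rw [hq']
    field_simp
    ring
  have hA : Real.exp (-(rate κ * t)) ≥
      Real.exp (-(rate κ * s)) * (1 - rate κ * (t - s)) := by
    have h1 : Real.exp (-(rate κ * t)) =
        Real.exp (-(rate κ * s)) * Real.exp (-(rate κ * (t - s))) := by
      rw [← Real.exp_add]; congr 1; ring
    rw [h1]
    refine mul_le_mul_of_nonneg_left ?_ (Real.exp_pos _).le
    have := Real.add_one_le_exp (-(rate κ * (t - s)))
    linarith
  rw [he, thr, thr, ← hq]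
  have h2 : (1 - (1 - Real.exp (-(rate κ * s))) / (1 - q) + q / (1 - q)) =
      Real.exp (-(rate κ * s)) / (1 - q) := by
    field_simp
    ring
  rw [h2, ← sub_div, ← mul_div_assoc]
  refine div_le_div_of_nonneg_right ?_ hp.le
  linarith

/-! ### Greedy nets and centers -/

lemma mem_net_iff (d : ℕ → ℕ → ℝ) (k : ℤ) (u j : ℕ) :
    u ∈ net d k j ↔ u < j ∧ u ∈ net d k (u + 1) := by
  induction j with
  | zero => simp [net]
  | succ j ih =>
    rcases lt_trichotomy u j with h | h | h
    · have : u ∈ net d k (j + 1) ↔ u ∈ net d k j := by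
        rw [net]
        split_ifs
        · rw [Finset.mem_insert, or_iff_right (by omega)]
        · rfl
      rw [this, ih]
      constructor <;> rintro ⟨_, h'⟩ <;> exact ⟨by omega, h'⟩
    · subst h
      simp
    · refine iff_of_false (fun hm => ?_) (fun hm => by omega)
      rw [net] at hm
      split_ifs at hm
      · rcases Finset.mem_insert.1 hm with rfl | hm
        · omega
        · have := (ih.1 hm).1; omega
      · have := (ih.1 hm).1; omega

lemma lt_dist_of_mem_net {d : ℕ → ℕ → ℝ} {k : ℤ} {u j : ℕ} (hu : u ∈ net d k (u + 1))
    (hj : j ∈ net d k (j + 1)) (huj : u < j) : (2 : ℝ) ^ k / 4 < d u j := by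
  have huj' : u ∈ net d k j := (mem_net_iff d k u j).2 ⟨huj, hu⟩
  rw [net] at hj
  split_ifs at hj with h
  · exact h u huj'
  · exact absurd ((mem_net_iff d k j j).1 hj).1 (lt_irrefl _)

lemma zero_mem_net (d : ℕ → ℕ → ℝ) (k : ℤ) : 0 ∈ net d k (0 + 1) := by
  simp [net]

/-- The radius is never below `2 ^ k / 4`, the separation of the net, so the balls cover all points
for every seed. -/
lemma captures_of_le {d : ℕ → ℕ → ℝ} {k : ℤ} {u j : ℕ} (hu : u ∈ net d k (u + 1))
    (h : d u j ≤ 2 ^ k / 4) (ω : Seed) : Captures d k ω u j := by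
  refine ⟨hu, (thr_nonpos _ ?_).trans (ω u).2.1⟩
  have hp : (0 : ℝ) < 2 ^ k := by positivity
  rw [sub_nonpos, div_le_one hp]
  linarith

lemma exists_captures {d : ℕ → ℕ → ℝ} (hself : ∀ a, d a a = 0) (k : ℤ) (ω : Seed) (j : ℕ) :
    ∃ u ≤ j, Captures d k ω u j := by
  have hp : (0 : ℝ) < 2 ^ k := by positivity
  by_cases h : ∀ u ∈ net d k j, (2 : ℝ) ^ k / 4 < d u j
  · refine ⟨j, le_rfl, captures_of_le ?_ ?_ ω⟩
    · rw [net, if_pos h]; exact Finset.mem_insert_self _ _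
    · rw [hself]; positivity
  · push Not at h
    obtain ⟨u, hu, hle⟩ := h
    obtain ⟨h1, h2⟩ := (mem_net_iff d k u j).1 hu
    exact ⟨u, h1.le, captures_of_le h2 hle ω⟩

lemma captures_center {d : ℕ → ℕ → ℝ} (hself : ∀ a, d a a = 0) (k : ℤ) (ω : Seed) (j : ℕ) :
    Captures d k ω (center d k ω j) j := by
  obtain ⟨u, _, hu⟩ := exists_captures hself k ω j
  exact Nat.sInf_mem (s := {u | Captures d k ω u j}) ⟨u, hu⟩

/-- The online property of the partitions: the center of a point is settled when the point arrives.
-/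
lemma center_le_self {d : ℕ → ℕ → ℝ} (hself : ∀ a, d a a = 0) (k : ℤ) (ω : Seed) (j : ℕ) :
    center d k ω j ≤ j := by
  obtain ⟨u, huj, hu⟩ := exists_captures hself k ω j
  exact (Nat.sInf_le (s := {u | Captures d k ω u j}) hu).trans huj

lemma center_eq_iff {d : ℕ → ℕ → ℝ} (hself : ∀ a, d a a = 0) (k : ℤ) (ω : Seed) (j u : ℕ) :
    center d k ω j = u ↔ Captures d k ω u j ∧ ∀ v < u, ¬ Captures d k ω v j := by
  constructor
  · rintro rfl
    exact ⟨captures_center hself k ω j, fun v hv => Nat.notMem_of_lt_sInf hv⟩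
  · rintro ⟨h1, h2⟩
    refine le_antisymm (Nat.sInf_le (s := {u | Captures d k ω u j}) h1) ?_
    by_contra hlt
    exact h2 _ (not_le.1 hlt) (captures_center hself k ω j)

lemma dist_le_of_captures {d : ℕ → ℕ → ℝ} {k : ℤ} {ω : Seed} {u j : ℕ}
    (h : Captures d k ω u j) : d u j ≤ 2 ^ k / 2 := by
  by_contra hlt
  push Not at hlt
  have hp : (0 : ℝ) < 2 ^ k := by positivity
  have h1 : 1 < 4 * d u j / 2 ^ k - 1 := by
    rw [lt_sub_iff_add_lt, lt_div_iff₀ hp]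
    linarith
  exact absurd ((one_lt_thr (rank d k u) h1).trans_le h.2) (not_lt.2 (ω u).2.2)

lemma dist_le_of_levelRel {d : ℕ → ℕ → ℝ} (hd : IsPseudo d) {ω : Seed} {i : ℤ} {a b : ℕ}
    (h : levelRel d ω i a b) : d a b ≤ 2 ^ i := by
  have h1 := dist_le_of_captures (captures_center hd.self i ω a)
  have h2 := dist_le_of_captures (captures_center hd.self i ω b)
  rw [← h i le_rfl] at h2
  have h3 := hd.tri a (center d i ω a) b
  rw [hd.symm a (center d i ω a)] at h3
  linarith

/-- Index `0` belongs to every net and has priority over all others, so large scales have a single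
cluster. -/
lemma center_eq_zero {d : ℕ → ℕ → ℝ} {k : ℤ} {a : ℕ} (h : d 0 a ≤ 2 ^ k / 4) (ω : Seed) :
    center d k ω a = 0 :=
  Nat.eq_zero_of_le_zero (Nat.sInf_le (s := {u | Captures d k ω u a})
    (captures_of_le (zero_mem_net d k) h ω))

lemma levelRel_of_le {d : ℕ → ℕ → ℝ} {i : ℤ} {a b : ℕ} (ha : d 0 a ≤ 2 ^ i / 4)
    (hb : d 0 b ≤ 2 ^ i / 4) (ω : Seed) : levelRel d ω i a b := by
  intro k hk
  have : (2 : ℝ) ^ i ≤ 2 ^ k := zpow_le_zpow_right₀ one_le_two hk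
  rw [center_eq_zero (by linarith) ω, center_eq_zero (by linarith) ω]

lemma center_eq_of_dist_zero {d : ℕ → ℕ → ℝ} (hd : IsPseudo d) {a b : ℕ} (h : d a b = 0)
    (k : ℤ) (ω : Seed) : center d k ω a = center d k ω b := by
  unfold center
  congr 1
  ext u
  simp only [Set.mem_ofPred_eq, Captures, hd.eq_of_zero h u]

/-! #### Dependence on the revealed distances -/

lemma net_congr {d d' : ℕ → ℕ → ℝ} {m : ℕ} (h : ∀ a < m, ∀ b < m, d a b = d' a b) (k : ℤ) :
    ∀ j ≤ m, net d k j = net d' k j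
  | 0, _ => rfl
  | j + 1, hj => by
    have ih := net_congr h k j (by omega)
    rw [net, net, ih]
    refine if_congr (forall₂_congr fun u hu => ?_) rfl rfl
    rw [h u (((mem_net_iff d' k u j).1 hu).1.trans hj) j hj]

lemma rank_congr {d d' : ℕ → ℕ → ℝ} {m : ℕ} (h : ∀ a < m, ∀ b < m, d a b = d' a b) (k : ℤ)
    {u : ℕ} (hu : u < m) : rank d k u = rank d' k u := by
  rw [rank, rank, net_congr h k u hu.le]
  congr 1
  refine Finset.filter_congr fun w hw => ?_
  rw [h w (((mem_net_iff d' k w u).1 hw).1.trans hu) u hu]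

lemma captures_congr {d d' : ℕ → ℕ → ℝ} {m : ℕ} (h : ∀ a < m, ∀ b < m, d a b = d' a b) (k : ℤ)
    (ω : Seed) {u j : ℕ} (hu : u < m) (hj : j < m) : Captures d k ω u j ↔ Captures d' k ω u j := by
  rw [Captures, Captures, net_congr h k (u + 1) hu, rank_congr h k hu, h u hu j hj]

lemma center_congr {d d' : ℕ → ℕ → ℝ} (hd : ∀ a, d a a = 0) (hd' : ∀ a, d' a a = 0) {m : ℕ}
    (h : ∀ a < m, ∀ b < m, d a b = d' a b) (k : ℤ) (ω : Seed) {j : ℕ} (hj : j < m) :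
    center d k ω j = center d' k ω j := by
  have hm := (center_le_self hd' k ω j).trans_lt hj
  rw [center_eq_iff hd, captures_congr h k ω hm hj]
  refine ⟨captures_center hd' k ω j, fun v hv => ?_⟩
  rw [captures_congr h k ω (hv.trans hm) hj]
  exact ((center_eq_iff hd' k ω j _).1 rfl).2 v hv

lemma levelRel_congr {d d' : ℕ → ℕ → ℝ} (hd : ∀ a, d a a = 0) (hd' : ∀ a, d' a a = 0) {m : ℕ}
    (h : ∀ a < m, ∀ b < m, d a b = d' a b) (ω : Seed) (i : ℤ) {a b : ℕ} (ha : a < m)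
    (hb : b < m) : levelRel d ω i a b ↔ levelRel d' ω i a b := by
  simp only [levelRel, center_congr hd hd' h _ ω ha, center_congr hd hd' h _ ω hb]

end OnlineMatching

namespace OnlineMatching

open scoped Classical
open MeasureTheory

/-! ### The probability of separating two points -/

/-- Independent uniform seeds. -/
noncomputable def seedMeasure : Measure Seed := Measure.infinitePi fun _ => volume

instance : IsProbabilityMeasure seedMeasure := by
  unfold seedMeasure
  infer_instance

lemma measurableSet_captures (d : ℕ → ℕ → ℝ) (k : ℤ) (u j : ℕ) :
    MeasurableSet {ω : Seed | Captures d k ω u j} := by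
  have h2 : MeasurableSet
      {ω : Seed | thr (rank d k u) (4 * d u j / 2 ^ k - 1) ≤ (ω u : ℝ)} :=
    measurableSet_le measurable_const (measurable_subtype_coe.comp (measurable_pi_apply u))
  exact (MeasurableSet.const _).inter h2

lemma measurable_center {d : ℕ → ℕ → ℝ} (hself : ∀ a, d a a = 0) (k : ℤ) (j : ℕ) :
    Measurable fun ω : Seed => center d k ω j := by
  refine measurable_to_countable' fun u => ?_
  have : (fun ω : Seed => center d k ω j) ⁻¹' {u} =
      {ω | Captures d k ω u j} ∩ ⋂ v, ⋂ (_ : v < u), {ω | Captures d k ω v j}ᶜ := by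
    ext ω
    simp only [Set.mem_preimage, Set.mem_singleton_iff, center_eq_iff hself, Set.mem_inter_iff,
      Set.mem_iInter, Set.mem_compl_iff, Set.mem_ofPred_eq]
  rw [this]
  exact (measurableSet_captures d k u j).inter (MeasurableSet.iInter fun v =>
    MeasurableSet.iInter fun _ => (measurableSet_captures d k v j).compl)

lemma measurableSet_center_ne {d : ℕ → ℕ → ℝ} (hself : ∀ a, d a a = 0) (k : ℤ) (x y : ℕ) :
    MeasurableSet {ω : Seed | center d k ω x ≠ center d k ω y} :=
  (measurableSet_eq_fun (measurable_center hself k x) (measurable_center hself k y)).compl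

lemma volume_real_Ico_le {a b : ℝ} (hab : a ≤ b) :
    (volume : Measure unitInterval).real {z | a ≤ (z : ℝ) ∧ (z : ℝ) < b} ≤ b - a := by
  refine ENNReal.toReal_le_of_le_ofReal (by linarith) ?_
  rw [unitInterval.volume_apply, ← Real.volume_Ico]
  refine measure_mono ?_
  rintro _ ⟨z, hz, rfl⟩
  exact hz

lemma one_sub_le_volume_real {a b : ℝ} (ha : 0 ≤ a) (hba : b ≤ a) :
    1 - a ≤ (volume : Measure unitInterval).real {z | b ≤ (z : ℝ)} := by
  by_cases ha1 : a ≤ 1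
  · have h1 : (volume : Measure unitInterval).real (Set.Ici ⟨a, ha, ha1⟩) = 1 - a := by
      rw [Measure.real, unitInterval.volume_Ici, ENNReal.toReal_ofReal (by simpa using ha1)]
    rw [← h1]
    exact measureReal_mono fun z hz => hba.trans hz
  · exact le_trans (by linarith) measureReal_nonneg

/-- The `j`-th element (from zero) has `κ ≥ j`, so the sum is dominated by the telescoping series of
`1 / ((j + 1) * (j + 2))`. -/
lemma sum_inv_le_one (Q : Finset ℕ) (κ : ℕ → ℕ)
    (h : ∀ u ∈ Q, (Q.filter (· < u)).card ≤ κ u) :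
    ∑ u ∈ Q, 1 / (((κ u : ℝ) + 1) * (κ u + 2)) ≤ 1 - 1 / ((Q.card : ℝ) + 1) := by
  induction Q using Finset.induction_on_max with
  | empty => simp
  | insert a Q hmax ih =>
    have ha : a ∉ Q := fun h => lt_irrefl _ (hmax a h)
    rw [Finset.sum_insert ha, Finset.card_insert_of_notMem ha]
    have ih' := ih fun u hu => (Finset.card_le_card (Finset.filter_subset_filter _
      (Finset.subset_insert a Q))).trans (h u (Finset.mem_insert_of_mem hu))
    have hκ := h a (Finset.mem_insert_self _ _)
    have hQ : ((insert a Q).filter (· < a)) = Q := by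
      ext v
      simp only [Finset.mem_filter, Finset.mem_insert]
      constructor
      · rintro ⟨rfl | hv, hlt⟩
        · exact absurd hlt (lt_irrefl _)
        · exact hv
      · exact fun hv => ⟨Or.inr hv, hmax v hv⟩
    rw [hQ] at hκ
    have hκ' : (Q.card : ℝ) ≤ κ a := by exact_mod_cast hκ
    have hq : (0 : ℝ) ≤ Q.card := Nat.cast_nonneg _
    have h1 : 1 / (((κ a : ℝ) + 1) * (κ a + 2)) ≤ 1 / (((Q.card : ℝ) + 1) * (Q.card + 2)) := by
      refine one_div_le_one_div_of_le (by positivity) ?_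
      gcongr
    have h2 : 1 / (((Q.card : ℝ) + 1) * (Q.card + 2)) =
        1 / ((Q.card : ℝ) + 1) - 1 / ((Q.card : ℝ) + 1 + 1) := by
      field_simp
      ring
    push_cast
    linarith

/-- A union bound over the first net point that captures at least one of two points. -/
lemma measureReal_center_ne_le {d : ℕ → ℕ → ℝ} (hd : IsPseudo d) (k : ℤ) (x y : ℕ)
    (hxy : d x y ≤ 2 ^ k) {B : ℝ}
    (hB : ∀ u ≤ max x y, u ∈ net d k (u + 1) → d u x ≤ 2 * 2 ^ k → rate (rank d k u) ≤ B) :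
    seedMeasure.real {ω | center d k ω x ≠ center d k ω y} ≤ 8 * B * d x y / 2 ^ k := by
  have hp : (0 : ℝ) < 2 ^ k := by positivity
  set δ : ℝ := 4 * d x y / 2 ^ k with hδ
  have hδ0 : 0 ≤ δ := by
    have := hd.nonneg x y
    positivity
  set Q := net d k (max x y + 1) with hQ
  set tx : ℕ → ℝ := fun u => 4 * d u x / 2 ^ k - 1 with htx
  set ty : ℕ → ℝ := fun u => 4 * d u y / 2 ^ k - 1 with hty
  set lo : ℕ → ℝ := fun u => thr (rank d k u) (min (tx u) (ty u)) with hlo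
  set hi : ℕ → ℝ := fun u => thr (rank d k u) (max (tx u) (ty u)) with hhi
  set c : ℕ → ℝ := fun u => (volume : Measure unitInterval).real {z | lo u ≤ (z : ℝ)} with hc
  set p : ℕ → ℝ := fun u =>
    (volume : Measure unitInterval).real {z | lo u ≤ (z : ℝ) ∧ (z : ℝ) < hi u} with hpdef
  have netQ : ∀ u ∈ Q, net d k u = Q.filter (· < u) := by
    intro u hu
    have huJ := ((mem_net_iff d k u _).1 hu).1
    ext v
    rw [Finset.mem_filter, mem_net_iff d k v u, hQ, mem_net_iff d k v (max x y + 1)]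
    constructor
    · rintro ⟨h1, h2⟩; exact ⟨⟨by omega, h2⟩, h1⟩
    · rintro ⟨⟨_, h2⟩, h1⟩; exact ⟨h1, h2⟩
  -- The event that `u` captures exactly one of the two points while no earlier net point captures
  -- either. It constrains independent coordinates, so its measure is a product.
  set box : ℕ → Set Seed := fun u =>
    Set.pi ((insert u (Q.filter (· < u)) : Finset ℕ) : Set ℕ) fun v =>
      if v = u then {z : unitInterval | lo u ≤ (z : ℝ) ∧ (z : ℝ) < hi u}
      else {z : unitInterval | lo v ≤ (z : ℝ)}ᶜ with hbox
  have mlo : ∀ r : ℝ, MeasurableSet {z : unitInterval | r ≤ (z : ℝ)} := fun r =>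
    measurableSet_le measurable_const measurable_subtype_coe
  have mhi : ∀ r : ℝ, MeasurableSet {z : unitInterval | (z : ℝ) < r} := fun r =>
    measurableSet_lt measurable_subtype_coe measurable_const
  have boxm : ∀ u, seedMeasure.real (box u) = p u * ∏ v ∈ Q.filter (· < u), (1 - c v) := by
    intro u
    have hu : u ∉ Q.filter (· < u) := by simp
    rw [hbox, Measure.real, seedMeasure, Measure.infinitePi_pi]
    · rw [Finset.prod_insert hu, if_pos rfl, ENNReal.toReal_mul, ENNReal.toReal_prod]
      congr 1
      refine Finset.prod_congr rfl fun v hv => ?_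
      rw [if_neg (by rintro rfl; exact hu hv)]
      exact probReal_compl_eq_one_sub (mlo _)
    · intro v _
      split_ifs
      · exact (mlo _).inter (mhi _)
      · exact (mlo _).compl
  have hsub : {ω | center d k ω x ≠ center d k ω y} ⊆ ⋃ u ∈ Q, box u := by
    intro ω hne
    have key : ∀ a b : ℕ, max x y = max a b → center d k ω a < center d k ω b →
        (∀ u, lo u = thr (rank d k u) (min (4 * d u a / 2 ^ k - 1) (4 * d u b / 2 ^ k - 1))) →
        (∀ u, hi u = thr (rank d k u) (max (4 * d u a / 2 ^ k - 1) (4 * d u b / 2 ^ k - 1))) →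
        ω ∈ ⋃ u ∈ Q, box u := by
      intro a b hab hlt hl hh
      set u := center d k ω a with hu
      have hca : Captures d k ω u a := captures_center hd.self k ω a
      have huQ : u ∈ Q := by
        rw [hQ, mem_net_iff]
        refine ⟨?_, hca.1⟩
        have := center_le_self hd.self k ω a
        omega
      have hnb : ∀ v, v ≤ u → ¬ Captures d k ω v b := fun v hv =>
        Nat.notMem_of_lt_sInf (lt_of_le_of_lt hv hlt)
      have hna : ∀ v, v < u → ¬ Captures d k ω v a := fun v hv => Nat.notMem_of_lt_sInf hv
      refine Set.mem_iUnion₂.2 ⟨u, huQ, fun v hv => ?_⟩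
      rw [Finset.mem_coe, Finset.mem_insert, Finset.mem_filter] at hv
      dsimp only
      split_ifs with hvu
      · subst hvu
        refine ⟨?_, ?_⟩
        · rw [hl]
          exact (thr_mono _ (min_le_left _ _)).trans hca.2
        · rw [hh]
          refine lt_of_lt_of_le ?_ (thr_mono _ (le_max_right _ _))
          by_contra hcon
          exact hnb u le_rfl ⟨hca.1, not_lt.1 hcon⟩
      · have hv' : v ∈ Q ∧ v < u := hv.resolve_left hvu
        have hvn := ((mem_net_iff d k v _).1 hv'.1).2
        intro hcon
        have hcon' : lo v ≤ (ω v : ℝ) := hcon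
        rw [hl] at hcon'
        rcases min_cases (4 * d v a / (2 : ℝ) ^ k - 1) (4 * d v b / 2 ^ k - 1) with h | h
        · rw [h.1] at hcon'
          exact hna v hv'.2 ⟨hvn, hcon'⟩
        · rw [h.1] at hcon'
          exact hnb v hv'.2.le ⟨hvn, hcon'⟩
    rcases lt_or_gt_of_ne hne with h | h
    · exact key x y rfl h (fun _ => rfl) (fun _ => rfl)
    · exact key y x (max_comm _ _) h (fun _ => by rw [min_comm]) (fun _ => by rw [max_comm])
  have hc01 : ∀ u, 0 ≤ 1 - c u ∧ 0 ≤ c u := fun u =>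
    ⟨sub_nonneg.2 measureReal_le_one, measureReal_nonneg⟩
  have hprod : ∀ u, 0 ≤ ∏ v ∈ Q.filter (· < u), (1 - c v) ∧
      ∏ v ∈ Q.filter (· < u), (1 - c v) ≤ 1 := fun u =>
    ⟨Finset.prod_nonneg fun v _ => (hc01 v).1,
      Finset.prod_le_one (fun v _ => (hc01 v).1) fun v _ => by linarith [(hc01 v).2]⟩
  -- Only net points that can reach `x` or `y` matter.
  set Q' := Q.filter fun u => min (tx u) (ty u) ≤ 1 with hQ'
  have near : ∀ u ∈ Q', d u x ≤ 2 ^ k / 2 ∨ d u y ≤ 2 ^ k / 2 := by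
    intro u hu
    have h1 := (Finset.mem_filter.1 hu).2
    rw [min_le_iff] at h1
    refine h1.imp (fun h => ?_) (fun h => ?_)
    all_goals
      rw [htx] at *
      rw [sub_le_iff_le_add, div_le_iff₀ hp] at h
      linarith
  have near' : ∀ u ∈ Q', d u x ≤ 2 ^ k / 2 + d x y ∧ d u y ≤ 2 ^ k / 2 + d x y := by
    intro u hu
    have h1 := hd.tri u y x
    have h2 := hd.tri u x y
    have h3 := hd.symm y x
    have h4 := hd.nonneg x y
    rcases near u hu with h | h <;> constructor <;> linarith
  -- Two such net points are within `2 ^ k / 2 + 2 ^ k / 2 + d x y ≤ 2 * 2 ^ k` of each other, which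
  -- is the radius in `rank`.
  have hrank : ∀ u ∈ Q', (Q'.filter (· < u)).card ≤ rank d k u := by
    intro u hu
    refine Finset.card_le_card fun v hv => ?_
    obtain ⟨hv, hvu⟩ := Finset.mem_filter.1 hv
    rw [Finset.mem_filter, netQ u (Finset.mem_filter.1 hu).1, Finset.mem_filter]
    refine ⟨⟨(Finset.mem_filter.1 hv).1, hvu⟩, ?_⟩
    obtain ⟨h3, h4⟩ := near' u hu
    have h1 := hd.tri v x u
    have h2 := hd.tri v y u
    rw [hd.symm x u] at h1
    rw [hd.symm y u] at h2
    rcases near v hv with h | h <;> linarith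
  have hpu : ∀ u ∈ Q, u ∉ Q' → p u = 0 := by
    intro u hu hu'
    have h1 : 1 < min (tx u) (ty u) := by
      by_contra hcon
      exact hu' (Finset.mem_filter.2 ⟨hu, not_lt.1 hcon⟩)
    have h2 : {z : unitInterval | lo u ≤ (z : ℝ) ∧ (z : ℝ) < hi u} = ∅ := by
      refine Set.eq_empty_of_forall_notMem fun z hz => ?_
      have := one_lt_thr (rank d k u) h1
      exact absurd (this.trans_le hz.1) (not_lt.2 z.2.2)
    rw [hpdef]
    simp only [h2, measureReal_empty]
  have hpu' : ∀ u ∈ Q', p u ≤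
      δ * B * (c u + 1 / (((rank d k u : ℝ) + 1) * (rank d k u + 2))) := by
    intro u hu
    have huQ := (mem_net_iff d k u _).1 (Finset.mem_filter.1 hu).1
    have hBu := hB u (by omega) huQ.2 (by linarith [(near' u hu).1])
    set s := min (tx u) (ty u) with hs
    set t := max (tx u) (ty u) with ht
    have hst : s ≤ t := min_le_max
    -- Seeds are nonnegative, so negative arguments may be clipped to `0`; this keeps the lower
    -- threshold nonnegative without enlarging the interval.
    have hts : max t 0 - max s 0 ≤ δ := by
      have h1 : max t 0 - max s 0 ≤ t - s := by
        rcases max_cases t 0 with h | h <;> rcases max_cases s 0 with h' | h' <;>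
          rw [h.1, h'.1] <;> linarith
      refine h1.trans ?_
      rw [ht, hs, max_sub_min_eq_abs, abs_le, htx, hty, hδ]
      have h2 := hd.tri u y x
      have h3 := hd.tri u x y
      rw [hd.symm y x] at h2
      constructor
      · have : 0 ≤ (4 * d u y + 4 * d x y - 4 * d u x) / 2 ^ k := div_nonneg (by linarith) hp.le
        rw [sub_div, add_div] at this
        linarith
      · have : 0 ≤ (4 * d u x + 4 * d x y - 4 * d u y) / 2 ^ k := div_nonneg (by linarith) hp.le
        rw [sub_div, add_div] at this
        linarith
    have hm : max s 0 ≤ max t 0 := max_le_max_right 0 hst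
    have h0 : thr (rank d k u) 0 ≤ thr (rank d k u) (max s 0) := thr_mono _ (le_max_right _ _)
    rw [thr_zero] at h0
    have h1 : p u ≤ thr (rank d k u) (max t 0) - thr (rank d k u) (max s 0) := by
      refine le_trans (measureReal_mono ?_) (volume_real_Ico_le (thr_mono _ hm))
      rintro z ⟨hz1, hz2⟩
      refine ⟨?_, hz2.trans_le (thr_mono _ (le_max_left _ _))⟩
      rcases max_cases s 0 with h | h
      · rw [h.1]; exact hz1
      · rw [h.1, thr_zero]; exact z.2.1
    have h2 := thr_sub_le (rank d k u) (max s 0) (max t 0)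
    have h3 : 1 - thr (rank d k u) (max s 0) ≤ c u :=
      one_sub_le_volume_real h0 (thr_mono _ (le_max_left _ _))
    have hr := rate_pos (rank d k u)
    have hε : (0 : ℝ) ≤ 1 / (((rank d k u : ℝ) + 1) * (rank d k u + 2)) := by positivity
    have hcu := (hc01 u).2
    calc p u ≤ rate (rank d k u) * (max t 0 - max s 0) * (1 - thr (rank d k u) (max s 0) +
          1 / (((rank d k u : ℝ) + 1) * (rank d k u + 2))) := h1.trans h2
      _ ≤ rate (rank d k u) * (max t 0 - max s 0) *
          (c u + 1 / (((rank d k u : ℝ) + 1) * (rank d k u + 2))) := by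
        refine mul_le_mul_of_nonneg_left (by linarith) ?_
        exact mul_nonneg hr.le (by linarith)
      _ ≤ δ * B * (c u + 1 / (((rank d k u : ℝ) + 1) * (rank d k u + 2))) := by
        refine mul_le_mul_of_nonneg_right ?_ (by linarith)
        rw [mul_comm]
        exact mul_le_mul hts hBu hr.le hδ0
  -- Serves only to deduce `0 ≤ B` from `hB`.
  have hne : Q'.Nonempty := by
    obtain ⟨ω⟩ : Nonempty Seed := ⟨fun _ => 0⟩
    refine ⟨center d k ω x, Finset.mem_filter.2 ⟨?_, ?_⟩⟩
    · rw [hQ, mem_net_iff]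
      refine ⟨?_, (captures_center hd.self k ω x).1⟩
      have := center_le_self hd.self k ω x
      omega
    · refine min_le_of_left_le ?_
      have := dist_le_of_captures (captures_center hd.self k ω x)
      rw [htx]
      simp only
      rw [sub_le_iff_le_add, div_le_iff₀ hp]
      linarith
  have hBnn : 0 ≤ B := by
    obtain ⟨u, hu⟩ := hne
    have huQ := (mem_net_iff d k u _).1 (Finset.mem_filter.1 hu).1
    exact (rate_pos _).le.trans (hB u (by omega) huQ.2 (by linarith [(near' u hu).1]))
  -- The summands are the probabilities of disjoint events: `u` is the first to capture one of the
  -- points.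
  have hsum1 : ∑ u ∈ Q', c u * ∏ v ∈ Q.filter (· < u), (1 - c v) ≤ 1 := by
    refine (Finset.sum_le_sum_of_subset_of_nonneg (Finset.filter_subset _ _)
      fun u _ _ => mul_nonneg (hc01 u).2 (hprod u).1).trans ?_
    have h1 := Finset.prod_one_sub_ordered Q c
    have h2 : 0 ≤ ∏ v ∈ Q, (1 - c v) := Finset.prod_nonneg fun v _ => (hc01 v).1
    linarith
  have hsum2 : ∑ u ∈ Q', 1 / (((rank d k u : ℝ) + 1) * (rank d k u + 2)) ≤ 1 := by
    refine (sum_inv_le_one Q' (rank d k) hrank).trans ?_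
    have : (0 : ℝ) ≤ 1 / ((Q'.card : ℝ) + 1) := by positivity
    linarith
  calc seedMeasure.real {ω | center d k ω x ≠ center d k ω y}
      ≤ ∑ u ∈ Q, seedMeasure.real (box u) :=
        (measureReal_mono hsub (measure_ne_top _ _)).trans (measureReal_biUnion_finset_le _ _)
    _ = ∑ u ∈ Q', p u * ∏ v ∈ Q.filter (· < u), (1 - c v) := by
        rw [Finset.sum_congr rfl fun u _ => boxm u]
        refine (Finset.sum_subset (Finset.filter_subset _ _) fun u hu hu' => ?_).symm
        rw [hpu u hu hu', zero_mul]
    _ ≤ ∑ u ∈ Q', δ * B * (c u * ∏ v ∈ Q.filter (· < u), (1 - c v) +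
          1 / (((rank d k u : ℝ) + 1) * (rank d k u + 2))) := by
        refine Finset.sum_le_sum fun u hu => ?_
        have h1 := mul_le_mul_of_nonneg_right (hpu' u hu) (hprod u).1
        refine h1.trans ?_
        rw [mul_assoc]
        refine mul_le_mul_of_nonneg_left ?_ (mul_nonneg hδ0 hBnn)
        have hε : (0 : ℝ) ≤ 1 / (((rank d k u : ℝ) + 1) * (rank d k u + 2)) := by positivity
        have := mul_le_mul_of_nonneg_left (hprod u).2 hε
        linarith
    _ ≤ δ * B * 2 := by
        rw [← Finset.mul_sum, Finset.sum_add_distrib]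
        exact mul_le_mul_of_nonneg_left (by linarith) (mul_nonneg hδ0 hBnn)
    _ = 8 * B * d x y / 2 ^ k := by rw [hδ]; ring

end OnlineMatching

namespace OnlineMatching

open scoped Classical

/-! ### Doubling spaces -/

lemma firstPoints_finite {X : Type u} (x : ℕ → X) (m : ℕ) : (firstPoints x m).Finite :=
  (Set.finite_Iio m).image x

lemma mem_firstPoints {X : Type u} {x : ℕ → X} {m a : ℕ} (ha : a < m) : x a ∈ firstPoints x m :=
  ⟨a, ha, rfl⟩

section Doubling

variable {X : Type u} [MetricSpace X]

/-- The distances between the points of a sequence. -/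
def seqDist (x : ℕ → X) (a b : ℕ) : ℝ := dist (x a) (x b)

lemma isPseudo_seqDist (x : ℕ → X) : IsPseudo (seqDist x) :=
  ⟨fun _ => dist_self _, fun _ _ => dist_comm _ _, fun _ _ _ => dist_triangle _ _ _⟩

lemma IsDoublingConstant.exists_cover {S : Set X} {c : ℕ} (h : IsDoublingConstant S c) (j : ℕ) :
    ∀ p ∈ S, ∀ r : ℝ, 0 < r → ∃ t : Finset X, (t : Set X) ⊆ S ∧ t.card ≤ c ^ j ∧
      S ∩ Metric.closedBall p (2 ^ j * r) ⊆ ⋃ y ∈ t, Metric.closedBall y r := by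
  induction j with
  | zero =>
    intro p hp r _
    refine ⟨{p}, by simpa using hp, by simp, fun z hz => ?_⟩
    simpa using hz.2
  | succ j ih =>
    intro p hp r hr
    obtain ⟨t, htS, htc, ht⟩ := ih p hp (2 * r) (by positivity)
    have hex : ∀ y : X, ∃ s : Finset X, (s : Set X) ⊆ S ∧ s.card ≤ c ∧
        (y ∈ t → S ∩ Metric.closedBall y (2 * r) ⊆ ⋃ z ∈ s, Metric.closedBall z r) := by
      intro y
      by_cases hy : y ∈ t
      · obtain ⟨s, h1, h2, h3⟩ := h y (htS hy) r hr
        exact ⟨s, h1, h2, fun _ => h3⟩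
      · exact ⟨∅, by simp, by simp, fun hy' => absurd hy' hy⟩
    choose s hsS hsc hs using hex
    refine ⟨t.biUnion s, ?_, ?_, ?_⟩
    · intro z hz
      obtain ⟨y, _, hz⟩ := Finset.mem_biUnion.1 (Finset.mem_coe.1 hz)
      exact hsS y hz
    · exact (Finset.card_biUnion_le_card_mul _ _ _ fun y _ => hsc y).trans
        (by rw [pow_succ]; exact Nat.mul_le_mul_right _ htc)
    · intro z hz
      have hz' : z ∈ S ∩ Metric.closedBall p (2 ^ j * (2 * r)) := by
        rw [← mul_assoc, ← pow_succ]; exact hz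
      obtain ⟨y, hy, hzy⟩ := Set.mem_iUnion₂.1 (ht hz')
      obtain ⟨w, hw, hzw⟩ := Set.mem_iUnion₂.1 (hs y hy ⟨hz.1, hzy⟩)
      exact Set.mem_iUnion₂.2 ⟨w, Finset.mem_biUnion.2 ⟨y, hy, hw⟩, hzw⟩

lemma IsDoublingConstant.two_le {S : Set X} {c : ℕ} (h : IsDoublingConstant S c) {a b : X}
    (ha : a ∈ S) (hb : b ∈ S) (hab : a ≠ b) : 2 ≤ c := by
  by_contra hc
  have hD : 0 < dist a b := dist_pos.2 hab
  obtain ⟨t, -, htc, ht⟩ := h.exists_cover 2 a ha (dist a b / 4) (by positivity)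
  have ht1 : t.card ≤ 1 := htc.trans (Nat.pow_le_one_iff (by norm_num) |>.2 (by omega))
  obtain ⟨y, hy, hay⟩ := Set.mem_iUnion₂.1 (ht ⟨ha, by
    rw [Metric.mem_closedBall, dist_self]; positivity⟩)
  obtain ⟨z, hz, hbz⟩ := Set.mem_iUnion₂.1 (ht ⟨hb, by
    rw [Metric.mem_closedBall, dist_comm]; linarith⟩)
  rw [Finset.card_le_one.1 ht1 z hz y hy] at hbz
  rw [Metric.mem_closedBall] at hay hbz
  have := dist_triangle_right a b y
  linarith

/-- The least doubling constant. -/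
noncomputable def doublingConst (S : Set X) : ℕ := sInf {k : ℕ | IsDoublingConstant S k}

lemma isDoublingConstant_doublingConst {S : Set X} (hS : S.Finite) :
    IsDoublingConstant S (doublingConst S) := by
  refine Nat.sInf_mem (s := {k : ℕ | IsDoublingConstant S k}) ⟨hS.toFinset.card, ?_⟩
  intro p hp r hr
  refine ⟨hS.toFinset, by simp, le_rfl, fun z hz => ?_⟩
  exact Set.mem_iUnion₂.2 ⟨z, by simpa using hz.1, by simpa using hr.le⟩

/-- Radius `2 * 2 ^ k` is `2 ^ 4` times `2 ^ k / 8`, and a ball of radius `2 ^ k / 8` cannot hold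
two net points. -/
lemma rank_le_doublingConst_pow (x : ℕ → X) {m : ℕ} (k : ℤ) {u : ℕ} (hu : u < m) :
    rank (seqDist x) k u ≤ doublingConst (firstPoints x m) ^ 4 := by
  have hp : (0 : ℝ) < 2 ^ k := by positivity
  obtain ⟨t, -, htc, ht⟩ := (isDoublingConstant_doublingConst
    (firstPoints_finite x m)).exists_cover 4 (x u) (mem_firstPoints hu) (2 ^ k / 8)
    (by positivity)
  refine le_trans ?_ htc
  have hex : ∀ w, ∃ y, w ∈ (net (seqDist x) k u).filter (fun w => seqDist x w u ≤ 2 * 2 ^ k) →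
      y ∈ t ∧ dist (x w) y ≤ 2 ^ k / 8 := by
    intro w
    by_cases hw : w ∈ (net (seqDist x) k u).filter (fun w => seqDist x w u ≤ 2 * 2 ^ k)
    · obtain ⟨hw1, hw2⟩ := Finset.mem_filter.1 hw
      obtain ⟨y, hy, hwy⟩ := Set.mem_iUnion₂.1 (ht
        ⟨mem_firstPoints (x := x) (((mem_net_iff _ k w u).1 hw1).1.trans hu), by
          rw [Metric.mem_closedBall]
          exact hw2.trans_eq (by ring)⟩)
      exact ⟨y, fun _ => ⟨hy, hwy⟩⟩
    · exact ⟨x u, fun h => absurd h hw⟩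
  choose f hf using hex
  have aux : ∀ v w, v ∈ net (seqDist x) k u → w ∈ net (seqDist x) k u → v < w →
      dist (x v) (f v) ≤ 2 ^ k / 8 → dist (x w) (f w) ≤ 2 ^ k / 8 → f v ≠ f w := by
    intro v w hv hw hvw h1 h2 he
    have h3 := lt_dist_of_mem_net ((mem_net_iff _ k v u).1 hv).2 ((mem_net_iff _ k w u).1 hw).2 hvw
    rw [← he] at h2
    have h4 := dist_triangle_right (x v) (x w) (f v)
    rw [seqDist] at h3
    linarith
  refine Finset.card_le_card_of_injOn f (fun w hw => Finset.mem_coe.2 (hf w hw).1) ?_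
  intro v hv w hw he
  by_contra hne
  have hv' := (Finset.mem_filter.1 (Finset.mem_coe.1 hv)).1
  have hw' := (Finset.mem_filter.1 (Finset.mem_coe.1 hw)).1
  rcases lt_or_gt_of_ne hne with h | h
  · exact aux v w hv' hw' h (hf v hv).2 (hf w hw).2 he
  · exact aux w v hw' hv' h (hf w hw).2 (hf v hv).2 he.symm

lemma rate_le_ddim (x : ℕ → X) {m : ℕ} (h2 : 2 ≤ doublingConst (firstPoints x m)) (k : ℤ)
    {u : ℕ} (hu : u < m) :
    rate (rank (seqDist x) k u) ≤ 12 * Real.log 2 * ddim (firstPoints x m) := by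
  set c := doublingConst (firstPoints x m) with hc
  have hlog2 : 0 < Real.log 2 := Real.log_pos one_lt_two
  have he : Real.log 2 * ddim (firstPoints x m) = Real.log c := by
    rw [ddim, ← doublingConst, ← hc, Real.logb]
    field_simp
  rw [mul_assoc, he, rate]
  have hr := rank_le_doublingConst_pow x k hu
  rw [← hc] at hr
  have hnat : 1 + (rank (seqDist x) k u + 1) * (rank (seqDist x) k u + 2) ≤ c ^ 12 := by
    have h3 : rank (seqDist x) k u + 2 ≤ c ^ 6 := by
      have h4 : 1 ≤ c ^ 4 := Nat.one_le_pow _ _ (by omega)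
      have h5 : 4 * c ^ 4 ≤ c ^ 6 := by
        rw [show c ^ 6 = c ^ 2 * c ^ 4 by ring]
        exact Nat.mul_le_mul_right _ (by nlinarith)
      omega
    calc 1 + (rank (seqDist x) k u + 1) * (rank (seqDist x) k u + 2)
        ≤ (rank (seqDist x) k u + 2) ^ 2 := by nlinarith
      _ ≤ (c ^ 6) ^ 2 := Nat.pow_le_pow_left h3 2
      _ = c ^ 12 := by ring
  have hreal : (1 : ℝ) + ((rank (seqDist x) k u : ℝ) + 1) * (rank (seqDist x) k u + 2) ≤
      (c : ℝ) ^ 12 := by exact_mod_cast hnat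
  refine (Real.log_le_log (by positivity) hreal).trans_eq ?_
  rw [Real.log_pow]
  norm_num

lemma one_le_ddim {S : Set X} (h2 : 2 ≤ doublingConst S) : 1 ≤ ddim S := by
  rw [ddim, ← doublingConst, Real.le_logb_iff_rpow_le one_lt_two (by positivity)]
  simpa using (show ((2 : ℕ) : ℝ) ≤ doublingConst S by exact_mod_cast h2)

lemma ddim_nonneg (S : Set X) : 0 ≤ ddim S := by
  rw [ddim]
  rcases Nat.eq_zero_or_pos (sInf {k : ℕ | IsDoublingConstant S k}) with h | h
  · rw [h]; simp
  · exact Real.logb_nonneg one_lt_two (by exact_mod_cast h)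

/-- The probability that two of the first `m` points are separated at scale `2 ^ k`. -/
lemma measureReal_center_ne_le_ddim (x : ℕ → X) {m : ℕ}
    (h2 : 2 ≤ doublingConst (firstPoints x m)) (k : ℤ) {v w : ℕ} (hv : v < m) (hw : w < m) :
    seedMeasure.real {ω | center (seqDist x) k ω v ≠ center (seqDist x) k ω w} ≤
      96 * ddim (firstPoints x m) * dist (x v) (x w) / 2 ^ k := by
  have hp : (0 : ℝ) < 2 ^ k := by positivity
  have hdd := one_le_ddim h2
  have hd0 : 0 ≤ dist (x v) (x w) := dist_nonneg
  by_cases hvw : dist (x v) (x w) ≤ 2 ^ k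
  · have hlog2 : Real.log 2 ≤ 1 := by
      have := Real.log_two_lt_d9
      linarith
    have hB : 12 * Real.log 2 * ddim (firstPoints x m) ≤ 12 * ddim (firstPoints x m) :=
      mul_le_mul_of_nonneg_right (by linarith) (by linarith)
    refine (measureReal_center_ne_le (isPseudo_seqDist x) k v w hvw fun u hu _ _ =>
      (rate_le_ddim x h2 k (by omega)).trans hB).trans_eq ?_
    rw [seqDist]
    ring
  · refine MeasureTheory.measureReal_le_one.trans ?_
    rw [le_div_iff₀ hp, one_mul]
    push Not at hvw
    nlinarith

end Doubling

end OnlineMatching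

namespace OnlineMatching

open scoped Classical
open MeasureTheory

/-! ### The sequence of pairings -/

/-- The pairing of `2 * i` with `2 * i + 1`. -/
def pairUp (v : ℕ) : ℕ := if v % 2 = 0 then v + 1 else v - 1

lemma isPairing_pairUp (n : ℕ) : IsPairing (Finset.range (2 * n)) pairUp := by
  refine ⟨fun v => ?_, fun v => ?_, fun v hv => ?_⟩
  · unfold pairUp; split_ifs <;> omega
  · unfold pairUp; split_ifs <;> omega
  · rw [Finset.mem_range] at hv ⊢
    unfold pairUp; split_ifs <;> omega

/-- `τ` is an admissible pairing of `2 * n + 2` points after `σ`. -/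
def IsRebalanced (R : ℤ → ℕ → ℕ → Prop) (n : ℕ) (σ τ : ℕ → ℕ) : Prop :=
  IsPairing (Finset.range (2 * n + 2)) τ ∧ (∀ v, v ∉ Finset.range (2 * n + 2) → τ v = σ v) ∧
    ((Finset.range (2 * n + 2)).filter fun v => τ v ≠ σ v).card ≤
      48 * ((lightLevels R (Finset.range (2 * n)) (2 * n)).ncard +
        (lightLevels R (Finset.range (2 * n + 1)) (2 * n + 1)).ncard) ∧
    Balanced R (Finset.range (2 * n + 2)) τ

/-- The pairings that the algorithm holds. -/
noncomputable def run (R : ℤ → ℕ → ℕ → Prop) : ℕ → ℕ → ℕ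
  | 0 => pairUp
  -- The fallback only makes the definition total; for hierarchies with finitely many light levels
  -- at each arrival it never occurs.
  | n + 1 => if h : ∃ τ, IsRebalanced R n (run R n) τ then h.choose else run R n

/-- Beyond the points seen the pairing is still `pairUp`, so a new pair starts out matched to itself
and only rebalancing remains. -/
lemma run_isPairing (R : ℤ → ℕ → ℕ → Prop) (n : ℕ) :
    IsPairing (Finset.range (2 * n)) (run R n) ∧ ∀ v, 2 * n ≤ v → run R n v = pairUp v := by
  induction n with
  | zero => exact ⟨isPairing_pairUp 0, fun _ _ => rfl⟩
  | succ n ih =>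
    rw [run, Nat.mul_succ]
    split_ifs with h
    · obtain ⟨h1, h2, _, _⟩ := h.choose_spec
      exact ⟨h1, fun v hv => (h2 v (by simpa using hv)).trans (ih.2 v (by omega))⟩
    · refine ⟨⟨ih.1.invol, ih.1.ne_self, fun v hv => ?_⟩, fun v hv => ih.2 v (by omega)⟩
      rw [Finset.mem_range] at hv ⊢
      by_cases hv' : v < 2 * n
      · have := Finset.mem_range.1 (ih.1.maps v (Finset.mem_range.2 hv'))
        omega
      · rw [ih.2 v (by omega)]
        have := (isPairing_pairUp (n + 1)).maps v (Finset.mem_range.2 (by omega))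
        rw [Finset.mem_range] at this
        omega

lemma run_isPairing_succ (R : ℤ → ℕ → ℕ → Prop) (n : ℕ) :
    IsPairing (Finset.range (2 * n + 2)) (run R n) := by
  obtain ⟨h1, h2⟩ := run_isPairing R n
  refine ⟨h1.invol, h1.ne_self, fun v hv => ?_⟩
  rw [Finset.mem_range] at hv ⊢
  by_cases hv' : v < 2 * n
  · have := Finset.mem_range.1 (h1.maps v (Finset.mem_range.2 hv'))
    omega
  · rw [h2 v (by omega)]
    have := (isPairing_pairUp (n + 1)).maps v (Finset.mem_range.2 (by omega))
    rw [Finset.mem_range] at this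
    omega

/-- The two points enter the balance condition one at a time, while the pairing lives on all `2 * n
+ 2` points throughout. -/
lemma exists_isRebalanced {R : ℤ → ℕ → ℕ → Prop} (hR : IsHierarchy R)
    (hfin : ∀ m, (lightLevels R (Finset.range m) m).Finite) {n : ℕ} {σ : ℕ → ℕ}
    (hσ : IsPairing (Finset.range (2 * n + 2)) σ) (h : Balanced R (Finset.range (2 * n)) σ) :
    ∃ τ, IsRebalanced R n σ τ := by
  obtain ⟨σ', h1, h2, h3, h4⟩ := h.exists_insert hR hσ (x := 2 * n) (by simp)
    (by rw [← Finset.range_add_one]; exact Finset.range_mono (by omega)) (hfin _)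
  rw [← Finset.range_add_one] at h4
  obtain ⟨τ, k1, k2, k3, k4⟩ := h4.exists_insert hR h1 (x := 2 * n + 1) (by simp)
    (by rw [← Finset.range_add_one]) (hfin _)
  rw [← Finset.range_add_one] at k4
  refine ⟨τ, k1, fun v hv => (k2 v hv).trans (h2 v hv), ?_, k4⟩
  have := card_filter_ne_trans (Finset.range (2 * n + 2)) σ σ' τ
  omega

lemma run_balanced {R : ℤ → ℕ → ℕ → Prop} (hR : IsHierarchy R)
    (hfin : ∀ m, (lightLevels R (Finset.range m) m).Finite) (n : ℕ) :
    Balanced R (Finset.range (2 * n)) (run R n) ∧ IsRebalanced R n (run R n) (run R (n + 1)) := by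
  have key : ∀ n, Balanced R (Finset.range (2 * n)) (run R n) →
      IsRebalanced R n (run R n) (run R (n + 1)) := by
    intro n hn
    have hex := exists_isRebalanced hR hfin (run_isPairing_succ R n) hn
    rw [run, dif_pos hex]
    exact hex.choose_spec
  have hb : ∀ n, Balanced R (Finset.range (2 * n)) (run R n) := by
    intro n
    induction n with
    | zero => intro i a ha; simp at ha
    | succ n ih => exact (key n ih).2.2.2
  exact ⟨hb n, key n (hb n)⟩

lemma cls_congr_rel {R R' : ℤ → ℕ → ℕ → Prop} {m : ℕ}
    (h : ∀ i, ∀ a < m, ∀ b < m, (R i a b ↔ R' i a b)) {V : Finset ℕ} (hV : ∀ v ∈ V, v < m)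
    {a : ℕ} (ha : a < m) (i : ℤ) : cls R V i a = cls R' V i a :=
  Finset.filter_congr fun v hv => h i a ha v (hV v hv)

lemma lightLevels_congr {R R' : ℤ → ℕ → ℕ → Prop} {m : ℕ}
    (h : ∀ i, ∀ a < m, ∀ b < m, (R i a b ↔ R' i a b)) {V : Finset ℕ} (hV : ∀ v ∈ V, v < m)
    {a : ℕ} (ha : a < m) : lightLevels R V a = lightLevels R' V a := by
  simp only [lightLevels, cls_congr_rel h hV ha]

lemma balanced_congr {R R' : ℤ → ℕ → ℕ → Prop} {m : ℕ}
    (h : ∀ i, ∀ a < m, ∀ b < m, (R i a b ↔ R' i a b)) {V : Finset ℕ} (hV : ∀ v ∈ V, v < m)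
    (σ : ℕ → ℕ) : Balanced R V σ ↔ Balanced R' V σ := by
  refine forall_congr' fun i => forall₂_congr fun a ha => ?_
  simp only [rest, capIn, capOut, cls_congr_rel h hV (hV a ha)]

/-- Choice is applied to equal predicates, hence gives equal pairings: the run depends only on what
has been revealed. -/
lemma run_congr {R R' : ℤ → ℕ → ℕ → Prop} (n : ℕ)
    (h : ∀ i, ∀ a < 2 * n, ∀ b < 2 * n, (R i a b ↔ R' i a b)) : run R n = run R' n := by
  induction n with
  | zero => rfl
  | succ n ih =>
    have ih' := ih fun i a ha b hb => h i a (by omega) b (by omega)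
    have hP : IsRebalanced R n (run R n) = IsRebalanced R' n (run R' n) := by
      funext τ
      rw [ih', IsRebalanced, IsRebalanced, lightLevels_congr h, lightLevels_congr h,
        balanced_congr h]
      all_goals first | omega | (intro v hv; rw [Finset.mem_range] at hv; omega)
    rw [run, run, hP, ih']

/-! ### Edge sets -/

/-- The edges of a pairing on the first `m` indices. -/
def edges (m : ℕ) (σ : ℕ → ℕ) : Finset (Sym2 ℕ) := (Finset.range m).image fun v => s(v, σ v)

lemma IsPairing.edge_eq_iff {U : Finset ℕ} {σ : ℕ → ℕ} (h : IsPairing U σ) (u v : ℕ) :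
    s(u, σ u) = s(v, σ v) ↔ u = v ∨ u = σ v := by
  rw [Sym2.eq_iff]
  constructor
  · rintro (⟨h1, _⟩ | ⟨h1, _⟩)
    · exact Or.inl h1
    · exact Or.inr h1
  · rintro (rfl | rfl)
    · exact Or.inl ⟨rfl, rfl⟩
    · exact Or.inr ⟨rfl, h.invol v⟩

lemma IsPairing.isPerfectMatching {m : ℕ} {σ : ℕ → ℕ} (h : IsPairing (Finset.range m) σ) :
    IsPerfectMatching m (edges m σ) := by
  refine ⟨fun e he => ?_, fun v hv => ?_⟩
  · obtain ⟨u, hu, rfl⟩ := Finset.mem_image.1 he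
    refine ⟨fun hd => h.ne_self u (Sym2.mk_isDiag_iff.1 hd).symm, fun w hw => ?_⟩
    rcases Sym2.mem_iff.1 hw with rfl | rfl
    · exact Finset.mem_range.1 hu
    · exact Finset.mem_range.1 (h.maps u hu)
  · refine ⟨s(v, σ v), ⟨Finset.mem_image_of_mem _ (Finset.mem_range.2 hv), Sym2.mem_mk_left _ _⟩,
      ?_⟩
    rintro e ⟨he, hve⟩
    obtain ⟨u, -, rfl⟩ := Finset.mem_image.1 he
    rw [h.edge_eq_iff]
    rcases Sym2.mem_iff.1 hve with rfl | rfl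
    · exact Or.inl rfl
    · exact Or.inr (h.invol u).symm

lemma IsPairing.two_mul_cost {X : Type*} [MetricSpace X] (x : ℕ → X) {m : ℕ} {σ : ℕ → ℕ}
    (h : IsPairing (Finset.range m) σ) :
    2 * cost x (edges m σ) = ∑ v ∈ Finset.range m, dist (x v) (x (σ v)) := by
  have hmaps : ∀ v ∈ Finset.range m, s(v, σ v) ∈ edges m σ := fun v hv =>
    Finset.mem_image_of_mem _ hv
  rw [← Finset.sum_fiberwise_of_maps_to hmaps, cost, Finset.mul_sum]
  refine Finset.sum_congr rfl fun e he => ?_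
  obtain ⟨u, hu, rfl⟩ := Finset.mem_image.1 he
  have hf : (Finset.range m).filter (fun v => s(v, σ v) = s(u, σ u)) = {u, σ u} := by
    ext v
    rw [Finset.mem_filter, h.edge_eq_iff, Finset.mem_insert, Finset.mem_singleton]
    constructor
    · exact fun hv => hv.2
    · rintro (rfl | rfl)
      · exact ⟨hu, Or.inl rfl⟩
      · exact ⟨h.maps u hu, Or.inr rfl⟩
  rw [hf, Finset.sum_pair (h.ne_self u).symm, h.invol, dist_comm (x (σ u)), Sym2.lift_mk, two_mul]

lemma IsPerfectMatching.exists_pairing {n : ℕ} {M : Finset (Sym2 ℕ)}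
    (hM : IsPerfectMatching (2 * n) M) :
    ∃ τ, IsPairing (Finset.range (2 * n)) τ ∧ M = edges (2 * n) τ := by
  obtain ⟨h1, h2⟩ := hM
  have hex : ∀ v, ∃ w, v < 2 * n → s(v, w) ∈ M := by
    intro v
    by_cases hv : v < 2 * n
    · obtain ⟨e, ⟨he, hve⟩, _⟩ := h2 v hv
      obtain ⟨w, rfl⟩ := hve
      exact ⟨w, fun _ => he⟩
    · exact ⟨0, fun h => absurd h hv⟩
  choose f hf using hex
  have flt : ∀ v < 2 * n, f v < 2 * n := fun v hv => (h1 _ (hf v hv)).2 _ (Sym2.mem_mk_right _ _)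
  have fne : ∀ v < 2 * n, f v ≠ v := fun v hv he =>
    (h1 _ (hf v hv)).1 (Sym2.mk_isDiag_iff.2 he.symm)
  have finv : ∀ v < 2 * n, f (f v) = v := by
    intro v hv
    have he := (h2 (f v) (flt v hv)).unique ⟨hf _ (flt v hv), Sym2.mem_mk_left _ _⟩
      ⟨hf v hv, Sym2.mem_mk_right _ _⟩
    rcases Sym2.eq_iff.1 he with ⟨h, _⟩ | ⟨_, h⟩
    · exact absurd h (fne v hv)
    · exact h
  have hp := isPairing_pairUp n
  have pge : ∀ v, ¬ v < 2 * n → ¬ pairUp v < 2 * n := by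
    intro v hv hlt
    have := hp.maps _ (Finset.mem_range.2 hlt)
    rw [hp.invol, Finset.mem_range] at this
    exact hv this
  refine ⟨fun v => if v < 2 * n then f v else pairUp v, ⟨?_, ?_, ?_⟩, ?_⟩
  · intro v
    by_cases hv : v < 2 * n
    · simp only [hv, if_true, flt v hv, finv v hv]
    · simp only [hv, if_false, pge v hv, hp.invol]
  · intro v
    by_cases hv : v < 2 * n
    · simp only [hv, if_true]; exact fne v hv
    · simp only [hv, if_false]; exact hp.ne_self v
  · intro v hv
    rw [Finset.mem_range] at hv ⊢
    simp only [hv, if_true]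
    exact flt v hv
  · ext e
    simp only [edges, Finset.mem_image, Finset.mem_range]
    constructor
    · intro he
      induction e using Sym2.ind with
      | _ a b =>
        have ha := (h1 _ he).2 a (Sym2.mem_mk_left _ _)
        refine ⟨a, ha, ?_⟩
        rw [if_pos ha]
        exact (h2 a ha).unique ⟨hf a ha, Sym2.mem_mk_left _ _⟩ ⟨he, Sym2.mem_mk_left _ _⟩
    · rintro ⟨v, hv, rfl⟩
      rw [if_pos hv]
      exact hf v hv

lemma card_edges_sdiff_le (m m' : ℕ) (hm : m ≤ m') (σ τ : ℕ → ℕ) :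
    (edges m σ \ edges m' τ).card ≤ ((Finset.range m').filter fun v => τ v ≠ σ v).card := by
  refine le_trans (Finset.card_le_card ?_) (Finset.card_image_le (f := fun v => s(v, σ v)))
  intro e he
  obtain ⟨he, he'⟩ := Finset.mem_sdiff.1 he
  obtain ⟨v, hv, rfl⟩ := Finset.mem_image.1 he
  have hv' : v ∈ Finset.range m' := Finset.range_mono hm hv
  refine Finset.mem_image.2 ⟨v, Finset.mem_filter.2 ⟨hv', fun h => he' ?_⟩, rfl⟩
  rw [← h]
  exact Finset.mem_image_of_mem _ hv'

/-! ### The algorithm -/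

lemma levelRel_const {d : ℕ → ℕ → ℝ} (hd : IsPseudo d) (ω : Seed) {i : ℤ} {a b : ℕ}
    (hi : 0 < d a b → 2 ^ i < d a b) : levelRel d ω i a b ↔ d a b = 0 := by
  constructor
  · intro h
    by_contra hne
    exact absurd (dist_le_of_levelRel hd h)
      (not_le.2 (hi (lt_of_le_of_ne (hd.nonneg a b) (Ne.symm hne))))
  · exact fun h k _ => center_eq_of_dist_zero hd h k ω

lemma exists_scales (d : ℕ → ℕ → ℝ) (m : ℕ) :
    ∃ (lo : ℤ) (N : ℕ), (∀ a < m, ∀ b < m, 0 < d a b → (2 : ℝ) ^ lo < d a b) ∧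
      ∀ a < m, d 0 a ≤ 2 ^ (lo + N) / 4 := by
  have h1 : ∃ ε : ℝ, 0 < ε ∧ ∀ t ∈ Finset.range m ×ˢ Finset.range m,
      0 < d t.1 t.2 → ε ≤ d t.1 t.2 := by
    induction Finset.range m ×ˢ Finset.range m using Finset.induction_on with
    | empty => exact ⟨1, one_pos, by simp⟩
    | insert t T _ ih =>
      obtain ⟨ε, hε, h⟩ := ih
      by_cases ht : 0 < d t.1 t.2
      · refine ⟨min ε (d t.1 t.2), lt_min hε ht, fun s hs hs' => ?_⟩
        rcases Finset.mem_insert.1 hs with rfl | hs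
        · exact min_le_right _ _
        · exact (min_le_left _ _).trans (h s hs hs')
      · refine ⟨ε, hε, fun s hs hs' => ?_⟩
        rcases Finset.mem_insert.1 hs with rfl | hs
        · exact absurd hs' ht
        · exact h s hs hs'
  obtain ⟨ε, hε, hlo⟩ := h1
  obtain ⟨p, hp⟩ := exists_pow_lt_of_lt_one hε (show (1 / 2 : ℝ) < 1 by norm_num)
  have h2 : ∃ B : ℝ, ∀ a ∈ Finset.range m, d 0 a ≤ B :=
    ⟨∑ a ∈ Finset.range m, |d 0 a|, fun a ha => (le_abs_self _).trans
      (Finset.single_le_sum (f := fun a => |d 0 a|) (fun _ _ => abs_nonneg _) ha)⟩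
  obtain ⟨B, hB⟩ := h2
  obtain ⟨q, hq⟩ := pow_unbounded_of_one_lt (4 * B) one_lt_two
  refine ⟨-(p : ℤ), p + q, fun a ha b hb hab => ?_, fun a ha => ?_⟩
  · refine lt_of_lt_of_le ?_ (hlo (a, b) (by simp [ha, hb]) hab)
    rwa [zpow_neg, zpow_natCast, ← inv_pow, ← one_div]
  · have h3 := hB a (Finset.mem_range.2 ha)
    have h4 : (-(p : ℤ) + ((p + q : ℕ) : ℤ)) = (q : ℤ) := by push_cast; ring
    rw [h4, zpow_natCast]
    linarith

lemma lightLevels_levelRel_subset {d : ℕ → ℕ → ℝ} (hd : IsPseudo d) (ω : Seed) {m : ℕ} {lo : ℤ}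
    {N : ℕ} (hlo : ∀ a < m + 1, ∀ b < m + 1, 0 < d a b → (2 : ℝ) ^ lo < d a b)
    (hhi : ∀ a < m + 1, d 0 a ≤ 2 ^ (lo + N) / 4) :
    lightLevels (levelRel d ω) (Finset.range m) m ⊆ Set.Ico lo (lo + N) := by
  refine lightLevels_subset_Ico (fun i hi v hv h => ?_) (fun i hi v hv => ?_)
  · have hv' := Finset.mem_range.1 hv
    have h0 := hlo m (by omega) v (by omega)
    have hle : ∀ j ≤ lo, 0 < d m v → (2 : ℝ) ^ j < d m v := fun j hj hp =>
      (zpow_le_zpow_right₀ one_le_two hj).trans_lt (h0 hp)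
    rw [levelRel_const hd ω (hle _ (by omega))] at h
    exact (levelRel_const hd ω (hle _ hi.le)).2 h
  · have hv' := Finset.mem_range.1 hv
    exact (isHierarchy_levelRel d ω).mono _ _ hi _ _
      (levelRel_of_le (hhi m (by omega)) (hhi v (by omega)) ω)

lemma lightLevels_levelRel_finite {d : ℕ → ℕ → ℝ} (hd : IsPseudo d) (ω : Seed) (m : ℕ) :
    (lightLevels (levelRel d ω) (Finset.range m) m).Finite := by
  obtain ⟨lo, N, h1, h2⟩ := exists_scales d (m + 1)
  exact (Set.finite_Ico lo (lo + N)).subset (lightLevels_levelRel_subset hd ω h1 h2)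

lemma ncard_lightLevels_levelRel_le {d : ℕ → ℕ → ℝ} (hd : IsPseudo d) (ω : Seed) {m : ℕ} {lo : ℤ}
    {N : ℕ} (hlo : ∀ a < m + 1, ∀ b < m + 1, 0 < d a b → (2 : ℝ) ^ lo < d a b)
    (hhi : ∀ a < m + 1, d 0 a ≤ 2 ^ (lo + N) / 4) :
    (lightLevels (levelRel d ω) (Finset.range m) m).ncard ≤ N := by
  refine (Set.ncard_le_ncard (lightLevels_levelRel_subset hd ω hlo hhi)
    (Set.finite_Ico _ _)).trans ?_
  rw [← Finset.coe_Ico, Set.ncard_coe_finset, Int.card_Ico]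
  omega

/-- A function of the hierarchy on finitely many points takes each of its values on a measurable
set of seeds. -/
lemma measurableSet_levelRel {d : ℕ → ℕ → ℝ} (hd : IsPseudo d) (m : ℕ) {α : Type*}
    (f : (ℤ → ℕ → ℕ → Prop) → α)
    (hf : ∀ R R' : ℤ → ℕ → ℕ → Prop,
      (∀ i, ∀ a < m, ∀ b < m, (R i a b ↔ R' i a b)) → f R = f R') (y : α) :
    MeasurableSet {ω : Seed | f (levelRel d ω) = y} := by
  obtain ⟨lo, N, hlo, hhi⟩ := exists_scales d m
  let sig : Seed → (Fin N × Fin m → ℕ) := fun ω t => center d (lo + (t.1 : ℕ)) ω t.2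
  have hsig : Measurable sig := measurable_pi_lambda _ fun t => measurable_center hd.self _ _
  -- Below `lo`, a common center forces distance zero, and above `lo + N` every center is `0`; so
  -- the finitely many centers in `sig` determine the hierarchy on the first `m` points.
  have hcenter : ∀ ω ω', sig ω = sig ω' → ∀ k, ∀ a < m, ∀ b < m,
      center d k ω a = center d k ω b → center d k ω' a = center d k ω' b := by
    intro ω ω' hs k a ha b hb h
    rcases lt_or_ge k lo with hk | hk
    · have h1 := dist_le_of_captures (captures_center hd.self k ω a)
      have h2 := dist_le_of_captures (captures_center hd.self k ω b)
      rw [← h] at h2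
      have h3 := hd.tri a (center d k ω a) b
      rw [hd.symm a (center d k ω a)] at h3
      have h4 : (2 : ℝ) ^ k ≤ 2 ^ lo := zpow_le_zpow_right₀ one_le_two hk.le
      refine center_eq_of_dist_zero hd (le_antisymm ?_ (hd.nonneg a b)) k ω'
      by_contra hpos
      have := hlo a ha b hb (not_le.1 hpos)
      linarith
    · rcases lt_or_ge k (lo + N) with hk' | hk'
      · obtain ⟨j, hj⟩ : ∃ j : ℕ, k = lo + j := ⟨(k - lo).toNat, by omega⟩
        subst hj
        have hjN : j < N := by omega
        have h1 := congrFun hs (⟨j, hjN⟩, ⟨a, ha⟩)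
        have h2 := congrFun hs (⟨j, hjN⟩, ⟨b, hb⟩)
        simp only [sig] at h1 h2
        rw [← h1, ← h2, h]
      · have h4 : (2 : ℝ) ^ (lo + (N : ℤ)) ≤ 2 ^ k := zpow_le_zpow_right₀ one_le_two hk'
        have ha' := hhi a ha
        have hb' := hhi b hb
        rw [center_eq_zero (by linarith) ω', center_eq_zero (by linarith) ω']
  have hset : {ω : Seed | f (levelRel d ω) = y} =
      sig ⁻¹' {s | ∃ ω, sig ω = s ∧ f (levelRel d ω) = y} := by
    ext ω
    simp only [Set.mem_ofPred_eq, Set.mem_preimage]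
    constructor
    · exact fun h => ⟨ω, rfl, h⟩
    · rintro ⟨ω', hs, h⟩
      rw [← h]
      refine hf _ _ fun i a ha b hb => ?_
      exact forall₂_congr fun k _ =>
        ⟨hcenter ω ω' hs.symm k a ha b hb, hcenter ω' ω hs k a ha b hb⟩
  rw [hset]
  exact hsig (Set.to_countable _).measurableSet

/-- The extension of a finite distance matrix to all indices by repetition of the last point. -/
def extend {m : ℕ} (D : Fin m → Fin m → ℝ) (a b : ℕ) : ℝ :=
  if h : 0 < m then D ⟨min a (m - 1), by omega⟩ ⟨min b (m - 1), by omega⟩ else 0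

lemma extend_revealed {X : Type*} [MetricSpace X] (x : ℕ → X) {m a b : ℕ} (ha : a < m)
    (hb : b < m) : extend (revealed x m) a b = seqDist x a b := by
  have h1 : min a (m - 1) = a := by omega
  have h2 : min b (m - 1) = b := by omega
  simp only [extend, revealed, dif_pos (show 0 < m by omega), h1, h2, seqDist]

lemma isPseudo_extend_revealed {X : Type*} [MetricSpace X] (x : ℕ → X) (m : ℕ) :
    IsPseudo (extend (revealed x m)) := by
  by_cases h : 0 < m
  · refine ⟨fun a => ?_, fun a b => ?_, fun a b c => ?_⟩ <;> simp only [extend, revealed, dif_pos h]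
    · exact dist_self _
    · exact dist_comm _ _
    · exact dist_triangle _ _ _
  · refine ⟨fun a => ?_, fun a b => ?_, fun a b c => ?_⟩ <;> simp only [extend, dif_neg h, add_zero,
      le_refl]

/-- The matching that the algorithm outputs. -/
noncomputable def outputMatching (n : ℕ) (D : Fin (2 * n) → Fin (2 * n) → ℝ) (ω : Seed) :
    Finset (Sym2 ℕ) :=
  if IsPseudo (extend D) then edges (2 * n) (run (levelRel (extend D) ω) n)
  else edges (2 * n) pairUp

/-- The algorithm: it keeps a balanced pairing with respect to the random hierarchy. -/
noncomputable def matchingAlgorithm : RandomizedAlgorithm where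
  Ω := Seed
  mΩ := inferInstance
  μ := seedMeasure
  prob := inferInstance
  output := outputMatching
  perfect := by
    intro n D ω
    rw [outputMatching]
    split_ifs
    · exact (run_isPairing _ n).1.isPerfectMatching
    · exact (isPairing_pairUp n).isPerfectMatching
  measurable := by
    intro n D M
    by_cases h : IsPseudo (extend D)
    · simp only [outputMatching, if_pos h]
      exact measurableSet_levelRel h (2 * n) (fun R => edges (2 * n) (run R n))
        (fun R R' hRR' => by rw [run_congr n hRR']) M
    · simp only [outputMatching, if_neg h]
      exact MeasurableSet.const _

lemma matchingAlgorithm_matching {X : Type*} [MetricSpace X] (x : ℕ → X) (n : ℕ) (ω : Seed) :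
    matchingAlgorithm.matching x n ω = edges (2 * n) (run (levelRel (seqDist x) ω) n) := by
  have h := isPseudo_extend_revealed x (2 * n)
  change outputMatching n (revealed x (2 * n)) ω = _
  rw [outputMatching, if_pos h]
  congr 1
  exact run_congr n fun i a ha b hb => levelRel_congr h.self (isPseudo_seqDist x).self
    (fun a ha b hb => extend_revealed x ha hb) ω i ha hb

end OnlineMatching

namespace OnlineMatching

open scoped Classical
open MeasureTheory

section Bounds

variable {X : Type u} [MetricSpace X]

/-! ### Scales and the aspect ratio -/

lemma one_le_aspectRatio {S : Set X} (hS : S.Finite) (hn : S.Nontrivial) : 1 ≤ aspectRatio S := by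
  have h1 := hS.infsep_pos_iff_nontrivial.2 hn
  obtain ⟨a, ha, b, hb, hab⟩ := hn
  rw [aspectRatio, one_le_div h1]
  exact (Set.infsep_le_dist_of_mem ha hb hab).trans
    (Metric.dist_le_diam_of_mem hS.isBounded ha hb)

lemma log_aspectRatio_nonneg {S : Set X} (hS : S.Finite) : 0 ≤ Real.log (aspectRatio S) := by
  by_cases hn : S.Nontrivial
  · exact Real.log_nonneg (one_le_aspectRatio hS hn)
  · rw [Set.not_nontrivial_iff] at hn
    rw [aspectRatio, hn.infsep_zero, div_zero, Real.log_zero]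

/-- The number of relevant scales is logarithmic in the aspect ratio. -/
lemma exists_scales_aspectRatio (x : ℕ → X) {m : ℕ} (hn : (firstPoints x m).Nontrivial) :
    ∃ (lo : ℤ) (N : ℕ),
      (∀ a < m, ∀ b < m, 0 < seqDist x a b → (2 : ℝ) ^ lo < seqDist x a b) ∧
      (∀ a < m, seqDist x 0 a ≤ 2 ^ (lo + N) / 4) ∧
      (N : ℝ) ≤ 4 * (1 + Real.log (aspectRatio (firstPoints x m))) := by
  set S := firstPoints x m with hS
  have hfin : S.Finite := firstPoints_finite x m
  have hs : 0 < S.infsep := hfin.infsep_pos_iff_nontrivial.2 hn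
  have hA := one_le_aspectRatio hfin hn
  have hsD : S.infsep ≤ Metric.diam S := by rwa [aspectRatio, one_le_div hs] at hA
  have hD : 0 < Metric.diam S := hs.trans_le hsD
  have hlogs : Real.logb 2 S.infsep ≤ Real.logb 2 (4 * Metric.diam S) :=
    Real.logb_le_logb_of_le one_lt_two hs (by linarith)
  set p := ⌈Real.logb 2 S.infsep⌉ with hp
  set q := ⌈Real.logb 2 (4 * Metric.diam S)⌉ with hq
  have hpq : p ≤ q := Int.ceil_le_ceil hlogs
  -- Subtracting 1 from the ceiling makes `2 ^ lo` strictly smaller than the least nonzero distance.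
  refine ⟨p - 1, (q - (p - 1)).toNat, fun a ha b hb hab => ?_, fun a ha => ?_, ?_⟩
  · have hne : x a ≠ x b := dist_pos.1 hab
    refine lt_of_lt_of_le ?_ (Set.infsep_le_dist_of_mem (mem_firstPoints ha) (mem_firstPoints hb)
      hne)
    rw [← Real.rpow_intCast, ← Real.lt_logb_iff_rpow_lt one_lt_two hs]
    push_cast
    linarith [Int.ceil_lt_add_one (Real.logb 2 S.infsep)]
  · have he : p - 1 + (((q - (p - 1)).toNat : ℕ) : ℤ) = q := by omega
    have h1 : seqDist x 0 a ≤ Metric.diam S := Metric.dist_le_diam_of_mem hfin.isBounded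
      (mem_firstPoints (by omega)) (mem_firstPoints ha)
    have h2 : 4 * Metric.diam S ≤ (2 : ℝ) ^ q := by
      rw [← Real.rpow_intCast, ← Real.logb_le_iff_le_rpow one_lt_two (by positivity)]
      exact Int.le_ceil _
    rw [he]
    linarith
  · have he : (((q - (p - 1)).toNat : ℕ) : ℝ) = (q : ℝ) - p + 1 := by
      have : (((q - (p - 1)).toNat : ℕ) : ℤ) = q - p + 1 := by omega
      exact_mod_cast this
    have h1 := Int.ceil_lt_add_one (Real.logb 2 (4 * Metric.diam S))
    have h2 := Int.le_ceil (Real.logb 2 S.infsep)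
    have h4 : Real.logb 2 4 = 2 := by
      rw [show (4 : ℝ) = 2 ^ (2 : ℕ) by norm_num, Real.logb_pow, Real.logb_self_eq_one one_lt_two]
      norm_num
    have h3 : Real.logb 2 (4 * Metric.diam S) - Real.logb 2 S.infsep =
        2 + Real.logb 2 (aspectRatio S) := by
      rw [aspectRatio, Real.logb_div hD.ne' hs.ne', Real.logb_mul (by norm_num) hD.ne', h4]
      ring
    have h5 : Real.logb 2 (aspectRatio S) ≤ 2 * Real.log (aspectRatio S) := by
      have hl := log_aspectRatio_nonneg hfin
      have hl2 := Real.log_two_gt_d9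
      rw [Real.logb, div_le_iff₀ (by linarith)]
      nlinarith
    rw [he]
    have hl := log_aspectRatio_nonneg hfin
    linarith

/-! ### Recourse -/

lemma matchingAlgorithm_recourse (x : ℕ → X) (n : ℕ) (ω : Seed) :
    matchingAlgorithm.recourse x n ω =
      (edges (2 * n) (run (levelRel (seqDist x) ω) n) \
        edges (2 * (n + 1)) (run (levelRel (seqDist x) ω) (n + 1))).card := by
  rw [← matchingAlgorithm_matching, ← matchingAlgorithm_matching]
  rfl

lemma recourse_le (x : ℕ → X) (n : ℕ) (ω : Seed) :
    matchingAlgorithm.recourse x n ω ≤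
      48 * ((lightLevels (levelRel (seqDist x) ω) (Finset.range (2 * n)) (2 * n)).ncard +
        (lightLevels (levelRel (seqDist x) ω) (Finset.range (2 * n + 1)) (2 * n + 1)).ncard) := by
  have h := (run_balanced (isHierarchy_levelRel (seqDist x) ω)
    (lightLevels_levelRel_finite (isPseudo_seqDist x) ω) n).2
  rw [matchingAlgorithm_recourse]
  exact (card_edges_sdiff_le _ _ (by omega) _ _).trans h.2.2.1

lemma dist_eq_zero_of_not_nontrivial (x : ℕ → X) {m : ℕ} (hn : ¬ (firstPoints x m).Nontrivial)
    {a b : ℕ} (ha : a < m) (hb : b < m) : dist (x a) (x b) = 0 := by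
  rw [Set.not_nontrivial_iff] at hn
  rw [hn (mem_firstPoints ha) (mem_firstPoints hb), dist_self]

lemma recourse_le_aspectRatio (x : ℕ → X) (n : ℕ) (ω : Seed) :
    (matchingAlgorithm.recourse x n ω : ℝ) ≤
      384 * (1 + Real.log (aspectRatio (firstPoints x (2 * (n + 1))))) := by
  have hd := isPseudo_seqDist x
  have hrec : ∀ (lo : ℤ) (N : ℕ),
      (∀ a < 2 * n + 2, ∀ b < 2 * n + 2, 0 < seqDist x a b → (2 : ℝ) ^ lo < seqDist x a b) →
      (∀ a < 2 * n + 2, seqDist x 0 a ≤ 2 ^ (lo + N) / 4) →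
      matchingAlgorithm.recourse x n ω ≤ 96 * N := by
    intro lo N h1 h2
    have a1 := ncard_lightLevels_levelRel_le hd ω (m := 2 * n)
      (fun a ha b hb => h1 a (by omega) b (by omega)) (fun a ha => h2 a (by omega))
    have a2 := ncard_lightLevels_levelRel_le hd ω (m := 2 * n + 1)
      (fun a ha b hb => h1 a (by omega) b (by omega)) (fun a ha => h2 a (by omega))
    have := recourse_le x n ω
    omega
  by_cases hn : (firstPoints x (2 * (n + 1))).Nontrivial
  · obtain ⟨lo, N, h1, h2, h3⟩ := exists_scales_aspectRatio x hn
    have : (matchingAlgorithm.recourse x n ω : ℝ) ≤ 96 * N := by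
      exact_mod_cast hrec lo N h1 h2
    linarith
  · have h0 := hrec 0 0
      (fun a ha b hb hab => by
        rw [seqDist, dist_eq_zero_of_not_nontrivial x hn ha hb] at hab
        exact absurd hab (lt_irrefl _))
      (fun a ha => by
        rw [seqDist, dist_eq_zero_of_not_nontrivial x hn (by omega) ha]
        positivity)
    have h1 : (matchingAlgorithm.recourse x n ω : ℝ) = 0 := by
      exact_mod_cast Nat.le_zero.1 h0
    rw [h1]
    have := log_aspectRatio_nonneg (firstPoints_finite x (2 * (n + 1)))
    linarith

lemma recourse_le_log (x : ℕ → X) (n : ℕ) (ω : Seed) :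
    (matchingAlgorithm.recourse x n ω : ℝ) ≤ 4608 * Real.log ((n + 1 : ℕ) : ℝ) ^ 3 := by
  rcases Nat.eq_zero_or_pos n with rfl | hn
  · have : matchingAlgorithm.recourse x 0 ω = 0 := by
      rw [matchingAlgorithm_recourse]
      simp [edges]
    rw [this]
    simp
  · have hfin := lightLevels_levelRel_finite (isPseudo_seqDist x) ω
    have hR := isHierarchy_levelRel (seqDist x) ω
    have h1 := ncard_lightLevels_le_log hR (hfin (2 * n)) (m := 2 * (n + 1)) (by omega)
      (by rw [Finset.card_range]; omega)
    have h2 := ncard_lightLevels_le_log hR (hfin (2 * n + 1)) (m := 2 * (n + 1)) (by omega)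
      (by rw [Finset.card_range]; omega)
    have h3 : (matchingAlgorithm.recourse x n ω : ℝ) ≤ 48 *
        ((lightLevels (levelRel (seqDist x) ω) (Finset.range (2 * n)) (2 * n)).ncard +
        (lightLevels (levelRel (seqDist x) ω) (Finset.range (2 * n + 1)) (2 * n + 1)).ncard) := by
      exact_mod_cast recourse_le x n ω
    set L := Real.log ((n + 1 : ℕ) : ℝ) with hL
    have h4 : Real.log ((2 * (n + 1) : ℕ) : ℝ) = Real.log 2 + L := by
      rw [Nat.cast_mul, Real.log_mul (by norm_num) (by positivity), hL]
      norm_num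
    have hl1 := Real.log_two_gt_d9
    have hl2 := Real.log_two_lt_d9
    have hL2 : Real.log 2 ≤ L := Real.log_le_log two_pos (by exact_mod_cast Nat.succ_le_succ hn)
    have hLh : 1 / 2 ≤ L := by linarith
    have c1 : 1 / 4 ≤ L ^ 2 := by nlinarith
    -- The recourse is in fact linear in `L`; for `n ≥ 1` this is absorbed by the cube since `L ≥
    -- log 2 > 1 / 2`.
    have c2 : 1 / 4 * L ≤ L ^ 3 := by
      rw [pow_succ]
      exact mul_le_mul_of_nonneg_right c1 (by linarith)
    rw [h4] at h1 h2
    linarith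

/-! ### Expected weight -/

lemma cost_nonneg (x : ℕ → X) (M : Finset (Sym2 ℕ)) : 0 ≤ cost x M := by
  refine Finset.sum_nonneg fun e _ => ?_
  induction e using Sym2.ind with
  | _ a b => exact dist_nonneg

lemma sum_Ico_zpow_le (lo : ℤ) (k N : ℕ) :
    ∑ j ∈ Finset.Ico k N, (2 : ℝ) ^ (lo + k) / 2 ^ (lo + j) ≤ 2 := by
  have h1 : ∀ j ∈ Finset.Ico k N, (2 : ℝ) ^ (lo + k) / 2 ^ (lo + j) = (1 / 2) ^ (j - k) := by
    intro j hj
    have hkj := (Finset.mem_Ico.1 hj).1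
    rw [← zpow_sub₀ two_ne_zero, one_div, inv_pow, ← zpow_natCast, ← zpow_neg]
    congr 1
    omega
  rw [Finset.sum_congr rfl h1, Finset.sum_Ico_eq_sum_range]
  have h2 : ∀ j, k + j - k = j := fun j => by omega
  simp only [h2]
  exact sum_geometric_two_le _

/-- The part of the tree weight of the pairing `τ` that a seed contributes. -/
noncomputable def treeWeight (x : ℕ → X) (m : ℕ) (τ : ℕ → ℕ) (lo : ℤ) (N : ℕ) (ω : Seed) : ℝ :=
  ∑ k ∈ Finset.range N, ∑ v ∈ Finset.range m, ∑ j ∈ Finset.Ico k N,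
    (2 : ℝ) ^ (lo + k) * Set.indicator
      {ω | center (seqDist x) (lo + j) ω v ≠ center (seqDist x) (lo + j) ω (τ v)} 1 ω

/-- Level `k` separates an edge only if some scale `j ≥ k` does, and scales from `N` on separate
nothing. -/
lemma cost_run_le_treeWeight (x : ℕ → X) (n : ℕ) {τ : ℕ → ℕ}
    (hτ : IsPairing (Finset.range (2 * n)) τ) {lo : ℤ} {N : ℕ}
    (hlo : ∀ a < 2 * n, ∀ b < 2 * n, 0 < seqDist x a b → (2 : ℝ) ^ lo < seqDist x a b)
    (hhi : ∀ a < 2 * n, seqDist x 0 a ≤ 2 ^ (lo + N) / 4) (ω : Seed) :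
    cost x (edges (2 * n) (run (levelRel (seqDist x) ω) n)) ≤
      3 * treeWeight x (2 * n) τ lo N ω := by
  have hd := isPseudo_seqDist x
  have hR := isHierarchy_levelRel (seqDist x) ω
  have hσ := (run_isPairing (levelRel (seqDist x) ω) n).1
  have hb := (run_balanced hR (lightLevels_levelRel_finite hd ω) n).1
  have htop : ∀ v ∈ Finset.range (2 * n), ∀ w ∈ Finset.range (2 * n),
      levelRel (seqDist x) ω (lo + N) v w := fun v hv w hw =>
    levelRel_of_le (hhi v (Finset.mem_range.1 hv)) (hhi w (Finset.mem_range.1 hw)) ω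
  have h1 := hb.sum_dist_le hR hσ hτ (seqDist x) lo N
    (fun v hv w hw h => (levelRel_const hd ω (hlo v (Finset.mem_range.1 hv) w
      (Finset.mem_range.1 hw))).1 h)
    (fun v _ w _ i h => dist_le_of_levelRel hd h) htop
  have h2 := hσ.two_mul_cost x
  have h3 : ∑ k ∈ Finset.range N, (2 : ℝ) ^ (lo + k) *
      sepCount (levelRel (seqDist x) ω) (Finset.range (2 * n)) τ (lo + k) ≤
      treeWeight x (2 * n) τ lo N ω := by
    refine Finset.sum_le_sum fun k _ => ?_
    rw [← sum_ite_rel, Finset.mul_sum]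
    refine Finset.sum_le_sum fun v hv => ?_
    rw [← Finset.mul_sum]
    refine mul_le_mul_of_nonneg_left ?_ (by positivity)
    have hnn : ∀ j ∈ Finset.Ico k N, (0 : ℝ) ≤ Set.indicator
        {ω | center (seqDist x) (lo + j) ω v ≠ center (seqDist x) (lo + j) ω (τ v)} 1 ω :=
      fun j _ => Set.indicator_nonneg (fun _ _ => zero_le_one) _
    split_ifs with h
    · exact Finset.sum_nonneg hnn
    · have hex : ∃ l, lo + k ≤ l ∧ center (seqDist x) l ω v ≠ center (seqDist x) l ω (τ v) := by
        by_contra hcon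
        push Not at hcon
        exact h hcon
      obtain ⟨l, hl, hne⟩ := hex
      have hlN : l < lo + N := by
        by_contra hge
        exact hne (htop v hv _ (hτ.maps v hv) l (not_lt.1 hge))
      obtain ⟨j, rfl⟩ : ∃ j : ℕ, l = lo + j := ⟨(l - lo).toNat, by omega⟩
      have hj : j ∈ Finset.Ico k N := Finset.mem_Ico.2 ⟨by omega, by omega⟩
      refine le_trans ?_ (Finset.single_le_sum hnn hj)
      rw [Set.indicator_of_mem (by exact hne)]
      rfl
  have h4 : ∑ v ∈ Finset.range (2 * n), seqDist x v (run (levelRel (seqDist x) ω) n v) =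
      2 * cost x (edges (2 * n) (run (levelRel (seqDist x) ω) n)) := h2.symm
  rw [h4] at h1
  linarith

lemma integrable_center_indicator (x : ℕ → X) (c : ℝ) (k : ℤ) (v w : ℕ) :
    Integrable (fun ω : Seed => c * Set.indicator
      {ω | center (seqDist x) k ω v ≠ center (seqDist x) k ω w} (1 : Seed → ℝ) ω)
      seedMeasure :=
  ((integrable_const (1 : ℝ)).indicator
    (measurableSet_center_ne (isPseudo_seqDist x).self k v w)).const_mul c

/-- For each level the separation probabilities at coarser scales form a geometric series, which
costs a factor 2. Another 2 arises because every edge is seen from both ends, and `N` counts the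
levels. -/
lemma integral_treeWeight_le (x : ℕ → X) {n : ℕ} {τ : ℕ → ℕ}
    (h2 : 2 ≤ doublingConst (firstPoints x (2 * n)))
    (hτ : IsPairing (Finset.range (2 * n)) τ) (lo : ℤ) (N : ℕ) :
    Integrable (treeWeight x (2 * n) τ lo N) seedMeasure ∧
      ∫ ω, treeWeight x (2 * n) τ lo N ω ∂seedMeasure ≤
        384 * N * ddim (firstPoints x (2 * n)) * cost x (edges (2 * n) τ) := by
  have hint := fun (k j v : ℕ) =>
    integrable_center_indicator x ((2 : ℝ) ^ (lo + k)) (lo + j) v (τ v)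
  have hint1 := fun (k v : ℕ) => integrable_finsetSum (Finset.Ico k N) fun j _ => hint k j v
  have hint2 := fun (k : ℕ) => integrable_finsetSum (Finset.range (2 * n)) fun v _ => hint1 k v
  refine ⟨integrable_finsetSum (Finset.range N) fun k _ => hint2 k, ?_⟩
  unfold treeWeight
  rw [integral_finsetSum _ fun k _ => hint2 k]
  have hdd := ddim_nonneg (firstPoints x (2 * n))
  have hk : ∀ k ∈ Finset.range N, (∫ ω, ∑ v ∈ Finset.range (2 * n), ∑ j ∈ Finset.Ico k N,
      (2 : ℝ) ^ (lo + k) * Set.indicator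
      {ω | center (seqDist x) (lo + j) ω v ≠ center (seqDist x) (lo + j) ω (τ v)}
      (1 : Seed → ℝ) ω ∂seedMeasure) ≤
      384 * ddim (firstPoints x (2 * n)) * cost x (edges (2 * n) τ) := by
    intro k _
    rw [integral_finsetSum _ fun v _ => hint1 k v]
    have hv : ∀ v ∈ Finset.range (2 * n), (∫ ω, ∑ j ∈ Finset.Ico k N,
        (2 : ℝ) ^ (lo + k) * Set.indicator
        {ω | center (seqDist x) (lo + j) ω v ≠ center (seqDist x) (lo + j) ω (τ v)}
        (1 : Seed → ℝ) ω ∂seedMeasure) ≤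
        192 * ddim (firstPoints x (2 * n)) * dist (x v) (x (τ v)) := by
      intro v hv
      rw [integral_finsetSum _ fun j _ => hint k j v]
      have hj : ∀ j ∈ Finset.Ico k N, (∫ ω, (2 : ℝ) ^ (lo + k) * Set.indicator
          {ω | center (seqDist x) (lo + j) ω v ≠ center (seqDist x) (lo + j) ω (τ v)}
          (1 : Seed → ℝ) ω ∂seedMeasure) ≤
          96 * ddim (firstPoints x (2 * n)) * dist (x v) (x (τ v)) *
            ((2 : ℝ) ^ (lo + k) / 2 ^ (lo + j)) := by
        intro j _
        rw [integral_const_mul, integral_indicator_one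
          (measurableSet_center_ne (isPseudo_seqDist x).self _ _ _)]
        have h3 := measureReal_center_ne_le_ddim x h2 (lo + j) (Finset.mem_range.1 hv)
          (Finset.mem_range.1 (hτ.maps v hv))
        refine (mul_le_mul_of_nonneg_left h3 (by positivity)).trans_eq ?_
        ring
      refine (Finset.sum_le_sum hj).trans ?_
      rw [← Finset.mul_sum]
      have h4 := mul_le_mul_of_nonneg_left (sum_Ico_zpow_le lo k N)
        (show 0 ≤ 96 * ddim (firstPoints x (2 * n)) * dist (x v) (x (τ v)) by positivity)
      linarith
    refine (Finset.sum_le_sum hv).trans_eq ?_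
    rw [← Finset.mul_sum, ← hτ.two_mul_cost x]
    ring
  refine (Finset.sum_le_sum hk).trans_eq ?_
  rw [Finset.sum_const, Finset.card_range, nsmul_eq_mul]
  ring

lemma expectedCost_eq (x : ℕ → X) (n : ℕ) : matchingAlgorithm.expectedCost x n =
    ∫ ω, cost x (edges (2 * n) (run (levelRel (seqDist x) ω) n)) ∂seedMeasure := by
  simp only [← matchingAlgorithm_matching]
  rfl

lemma expectedCost_le (x : ℕ → X) (n : ℕ) :
    matchingAlgorithm.expectedCost x n ≤ 4608 * ddim (firstPoints x (2 * n)) *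
      (1 + Real.log (aspectRatio (firstPoints x (2 * n)))) * optCost x (2 * n) := by
  have hdd := ddim_nonneg (firstPoints x (2 * n))
  have hlog := log_aspectRatio_nonneg (firstPoints_finite x (2 * n))
  have hopt : 0 ≤ optCost x (2 * n) := by
    refine Real.sInf_nonneg ?_
    rintro _ ⟨M, _, rfl⟩
    exact cost_nonneg x M
  rw [expectedCost_eq]
  by_cases hn : (firstPoints x (2 * n)).Nontrivial
  · obtain ⟨lo, N, hlo, hhi, hN⟩ := exists_scales_aspectRatio x hn
    obtain ⟨a, ha, b, hb, hab⟩ := hn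
    have h2 := (isDoublingConstant_doublingConst (firstPoints_finite x (2 * n))).two_le ha hb hab
    have hdd1 := one_le_ddim h2
    set K := 4608 * ddim (firstPoints x (2 * n)) *
      (1 + Real.log (aspectRatio (firstPoints x (2 * n)))) with hK
    have hKpos : 0 < K := by positivity
    rw [← div_le_iff₀' hKpos]
    refine le_csInf ⟨_, edges (2 * n) pairUp, (isPairing_pairUp n).isPerfectMatching, rfl⟩ ?_
    rintro _ ⟨M, hM, rfl⟩
    obtain ⟨τ, hτ, rfl⟩ := hM.exists_pairing
    rw [div_le_iff₀' hKpos]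
    obtain ⟨hint, hle⟩ := integral_treeWeight_le x h2 hτ lo N
    calc ∫ ω, cost x (edges (2 * n) (run (levelRel (seqDist x) ω) n)) ∂seedMeasure
        ≤ ∫ ω, 3 * treeWeight x (2 * n) τ lo N ω ∂seedMeasure :=
          integral_mono_of_nonneg (ae_of_all _ fun ω => cost_nonneg x _) (hint.const_mul 3)
            (ae_of_all _ fun ω => cost_run_le_treeWeight x n hτ hlo hhi ω)
      _ ≤ 3 * (384 * N * ddim (firstPoints x (2 * n)) * cost x (edges (2 * n) τ)) := by
          rw [integral_const_mul]
          linarith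
      _ = N * (1152 * ddim (firstPoints x (2 * n)) * cost x (edges (2 * n) τ)) := by ring
      _ ≤ 4 * (1 + Real.log (aspectRatio (firstPoints x (2 * n)))) *
          (1152 * ddim (firstPoints x (2 * n)) * cost x (edges (2 * n) τ)) := by
          refine mul_le_mul_of_nonneg_right hN ?_
          have := cost_nonneg x (edges (2 * n) τ)
          positivity
      _ = K * cost x (edges (2 * n) τ) := by rw [hK]; ring
  · have h0 : ∀ ω, cost x (edges (2 * n) (run (levelRel (seqDist x) ω) n)) = 0 := by
      intro ω
      have hσ := (run_isPairing (levelRel (seqDist x) ω) n).1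
      have h1 := hσ.two_mul_cost x
      rw [Finset.sum_eq_zero fun v hv => dist_eq_zero_of_not_nontrivial x hn
        (Finset.mem_range.1 hv) (Finset.mem_range.1 (hσ.maps v hv))] at h1
      linarith
    simp only [h0, integral_zero]
    positivity

end Bounds

end OnlineMatching

theorem mainTheorem6 :
    ∃ C : ℝ, 0 < C ∧
      (∃ A : OnlineMatching.RandomizedAlgorithm,
        ∀ (X : Type u) [MetricSpace X] (x : ℕ → X) (n : ℕ),
          A.expectedCost x n ≤
            C * OnlineMatching.ddim (OnlineMatching.firstPoints x (2 * n)) *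
              (1 + Real.log (OnlineMatching.aspectRatio (OnlineMatching.firstPoints x (2 * n)))) *
              OnlineMatching.optCost x (2 * n) ∧
          ∀ ω : A.Ω, (A.recourse x n ω : ℝ) ≤
            C * (1 + Real.log (OnlineMatching.aspectRatio
              (OnlineMatching.firstPoints x (2 * (n + 1)))))) ∧
      (∃ A : OnlineMatching.RandomizedAlgorithm,
        ∀ (X : Type u) [MetricSpace X] (x : ℕ → X) (n : ℕ),
          A.expectedCost x n ≤
            C * OnlineMatching.ddim (OnlineMatching.firstPoints x (2 * n)) *
              (1 + Real.log (OnlineMatching.aspectRatio (OnlineMatching.firstPoints x (2 * n)))) *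
              OnlineMatching.optCost x (2 * n) ∧
          ∀ ω : A.Ω, (A.recourse x n ω : ℝ) ≤ C * Real.log ((n + 1 : ℕ) : ℝ) ^ 3) := by
  -- The cost constant is `3 * 384 * 4`, with `4` from the number of scales; it also exceeds the
  -- recourse constant 384.
  refine ⟨4608, by norm_num,
    ⟨OnlineMatching.matchingAlgorithm, fun X _ x n =>
      ⟨OnlineMatching.expectedCost_le x n, fun ω => ?_⟩⟩,
    ⟨OnlineMatching.matchingAlgorithm, fun X _ x n =>
      ⟨OnlineMatching.expectedCost_le x n, fun ω => OnlineMatching.recourse_le_log x n ω⟩⟩⟩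
  have h := OnlineMatching.log_aspectRatio_nonneg
    (OnlineMatching.firstPoints_finite x (2 * (n + 1)))
  exact (OnlineMatching.recourse_le_aspectRatio x n ω).trans (by linarith)
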